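/- Let $G$ be a countable discrete abelian group. Let $F$ assign to every $N\in\mathbb{N}_0=\{0,1,2,\dots\}$ an operation $$F(N)=(\gamma_N,\,s(N,0),\dots,s(N,\gamma_N-1),\,g(N,0),\dots,g(N,\gamma_N-1)),$$ where $\gamma_N>1$ is an integer, $s(N,i)\in\mathbb{N}_0$ and $g(N,i)\in G$. Assume that $F$ is recurrent: for all $n,d\in\mathbb{N}_0$ there are infinitely many $m$ with $F(n+i)=F(m+i)$ for all $0\le i<d$. Construct columns (finite sequences of intervals of equal length, called levels) as follows. For each $a\in G$ the column $C_{0,a}$ is a single interval of length $1$ (these intervals being pairwise disjoint). Given the columns $C_{N,a}$ ($a\in G$), all of height $h_N$, cut every level into $\gamma_N$ subintervals of equal length, numbered $0,\dots,\gamma_N-1$. The column $C_{N+1,a}$ is obtained by stacking, for $i=0,1,\dots,\gamma_N-1$ in this order from bottom to top, the $i$-th subintervals of the levels of $C_{N,a+g(N,i)}$ (in their order in that column) followed by $s(N,i)$ new disjoint intervals (spacers) of the same length. Thus $h_0=1$ and $h_{N+1}=\gamma_N h_N+\sum_{i=0}^{\gamma_N-1}s(N,i)$. Let $X$ be the union of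 all levels with Lebesgue measure $\mu$, and let $T$ be the (a.e. defined, invertible, measure-preserving) transformation of $X$ that maps every level of every column, except the top one, by translation onto the level directly above it. A transformation $S$ of a measure space $(Y,\nu)$ is ergodic if for all measurable $A,B$ of positive measure there is $i\ge 0$ with $\nu(S^{-i}A\cap B)>0$. $T$ is totally ergodic if $T^n$ is ergodic for every $n\ge 1$, and power weakly mixing if $T^{k_1}\times\cdots\times T^{k_d}$ is ergodic on $(X^d,\mu^d)$ for all $d\ge1$ and all nonzero integers $k_1,\dots,k_d$. In $\mathbb{Z}\times G$ put $$t_{N,i}=\bigl(s(N,i)+h_N,\ g(N,i+1)-g(N,i)\bigr)\qquad(0\le i\le\gamma_N-2),$$ $$c_{M,i}=\bigl(s(M+1,i)+s(M,\gamma_M-1)-s(M,0),\ g(M+1,i+1)-g(M+1,i)+2g(M,0)-g(M,\gamma_M-1)-g(M,1)\bigr)\qquad(0\le i\le\gamma_{M+1}-2),$$ and consider the conditions 1. $\{g(N,i)-g(N,0): N\in\mathbb{N}_0,\ 0\le i\le\gamma_N-1\}$ generates $G$; 2. for every $N\in\mathbb{N}_0$, $(1,0)$ lies in the integer span of $\{t_{N,i}:0\le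 i\le\gamma_N-2\}\cup\{c_{M,i}:M\in\mathbb{N}_0,\ 0\le i\le\gamma_{M+1}-2\}$. Then: (a) $T$ is power weakly mixing if and only if conditions 1 and 2 both hold; (b) $T$ is power weakly mixing if and only if $T$ is totally ergodic; (c) $T$ is ergodic if and only if condition 1 holds. -/

import Mathlib

open MeasureTheory

noncomputable section

/-- One cutting-and-stacking operation: the number `cuts > 1` of pieces into which every level is
cut, the number of spacers put above each piece, and the change of column index of each piece. -/
@[ext]
structure CutOp (G : Type*) where
  cuts : ℕ
  one_lt_cuts : 1 < cuts
  spacers : Fin cuts → ℕ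
  shifts : Fin cuts → G

namespace CutStack

variable {G : Type*} [AddCommGroup G]

/-- Every finite string of operations that occurs in `F` occurs infinitely often. -/
def Recurrent (F : ℕ → CutOp G) : Prop :=
  ∀ n d : ℕ, {m : ℕ | ∀ i < d, F (n + i) = F (m + i)}.Infinite

/-- The number `γ_N` of pieces into which the levels of generation `N` are cut. -/
def γ (F : ℕ → CutOp G) (N : ℕ) : ℕ := (F N).cuts

/-- The number `s(N, i)` of spacers; only used for `i < γ_N`. -/
def s (F : ℕ → CutOp G) (N i : ℕ) : ℕ :=
  if h : i < (F N).cuts then (F N).spacers ⟨i, h⟩ else 0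

/-- The change of column index `g(N, i)`; only used for `i < γ_N`. -/
def g (F : ℕ → CutOp G) (N i : ℕ) : G :=
  if h : i < (F N).cuts then (F N).shifts ⟨i, h⟩ else 0

/-- The common height `h_N` of the columns of generation `N`. -/
def height (F : ℕ → CutOp G) : ℕ → ℕ
  | 0 => 1
  | N + 1 => γ F N * height F N + ∑ i ∈ Finset.range (γ F N), s F N i

/-- The common length of the levels of generation `N`. -/
def width (F : ℕ → CutOp G) : ℕ → ℝ
  | 0 => 1
  | N + 1 => width F N / γ F N

/-- The column `C_{N,a}`, as the list of its levels from bottom to top. All intervals lie in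
`ℝ × G`, a disjoint union of copies of the line indexed by `G`; an entry `(t, b)` of the list
stands for the interval `[t, t + width N) × {b}`, see `level`.
`C_{N+1,a}` stacks, for `i = 0, …, γ_N - 1` in turn, the `i`-th pieces of the levels of
`C_{N, a + g(N,i)}` and then `s(N,i)` spacers. The generation-`N` intervals fill
`[0, h_N * width N) × G`; the new spacers of `C_{N+1,a}` are laid side by side directly to the right
of that in the copy of the line with index `a`. -/
def column (F : ℕ → CutOp G) : ℕ → G → List (ℝ × G)
  | 0, a => [(0, a)]
  | N + 1, a => (List.range (γ F N)).flatMap fun (i : ℕ) =>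
      (column F N (a + g F N i)).map (fun p => (p.1 + i * width F (N + 1), p.2)) ++
      (List.range (s F N i)).map (fun (j : ℕ) =>
        (height F N * width F N
          + ((∑ k ∈ Finset.range i, s F N k : ℕ) + j) * width F (N + 1), a))

/-- The interval of generation `N` given by an entry of a column. -/
def level (F : ℕ → CutOp G) (N : ℕ) (p : ℝ × G) : Set (ℝ × G) :=
  Set.Ico p.1 (p.1 + width F N) ×ˢ {p.2}

/-- The union of all levels of all columns: the space on which the transformation lives. -/
def space (F : ℕ → CutOp G) : Set (ℝ × G) :=
  {x | ∃ N a, ∃ p ∈ column F N a, x ∈ level F N p}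

/-- The invariant measure: Lebesgue measure on every copy of the line, restricted to the space. -/
def μ [MeasurableSpace G] (F : ℕ → CutOp G) : Measure (ℝ × G) :=
  ((volume : Measure ℝ).prod (Measure.count : Measure G)).restrict (space F)

/-- `y` is the point directly above `x` in some column: `q` is the level that follows the level
`p` of that column, and `y ∈ q` is the image of `x ∈ p` under the translation from `p` to `q`. -/
def Above (F : ℕ → CutOp G) (x y : ℝ × G) : Prop :=
  ∃ N a p q, [p, q] <:+: column F N a ∧ x ∈ level F N p ∧ y = (x.1 + (q.1 - p.1), q.2)

open Classical in
/-- The transformation: it sends a point to the point directly above it. (The point above is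
unique; points without one form a null set of the space and are fixed.) -/
def T (F : ℕ → CutOp G) (x : ℝ × G) : ℝ × G :=
  if h : ∃ y, Above F x y then h.choose else x

open Classical in
/-- The inverse transformation (up to a null set): it sends a point to the point directly below
it. -/
def Tinv (F : ℕ → CutOp G) (y : ℝ × G) : ℝ × G :=
  if h : ∃ x, Above F x y then h.choose else y

/-- The integer powers of the transformation. -/
def Tpow (F : ℕ → CutOp G) : ℤ → ℝ × G → ℝ × G
  | Int.ofNat n => (T F)^[n]
  | Int.negSucc n => (Tinv F)^[n + 1]

/-- Ergodicity: for any two sets of positive measure some `f^{-i} A`, `i ≥ 0`, meets `B` in a set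
of positive measure. -/
def IsErgodic {Y : Type*} [MeasurableSpace Y] (ν : Measure Y) (f : Y → Y) : Prop :=
  ∀ A B : Set Y, MeasurableSet A → MeasurableSet B → 0 < ν A → 0 < ν B →
    ∃ i : ℕ, 0 < ν ((f^[i]) ⁻¹' A ∩ B)

/-- All positive powers of the transformation are ergodic. -/
def TotallyErgodic [MeasurableSpace G] (F : ℕ → CutOp G) : Prop :=
  ∀ n : ℕ, 0 < n → IsErgodic (μ F) (T F)^[n]

/-- `T^{k_1} × ⋯ × T^{k_d}` is ergodic for all nonzero integers `k_1, …, k_d`, `d > 0`. -/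
def PowerWeaklyMixing [MeasurableSpace G] (F : ℕ → CutOp G) : Prop :=
  ∀ (d : ℕ) (k : Fin d → ℤ), 0 < d → (∀ i, k i ≠ 0) →
    IsErgodic (Measure.pi fun _ : Fin d => μ F) (fun x i => Tpow F (k i) (x i))

/-- The vector `t_{N,i}`. -/
def t (F : ℕ → CutOp G) (N i : ℕ) : ℤ × G :=
  ((s F N i : ℤ) + height F N, g F N (i + 1) - g F N i)

/-- The vector `c_{M,i}`. -/
def c (F : ℕ → CutOp G) (M i : ℕ) : ℤ × G :=
  ((s F (M + 1) i : ℤ) + s F M (γ F M - 1) - s F M 0,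
    g F (M + 1) (i + 1) - g F (M + 1) i + (2 : ℕ) • g F M 0 - g F M (γ F M - 1) - g F M 1)

/-- The differences `g(N,i) - g(N,0)` generate `G`. -/
def ShiftsGenerate (F : ℕ → CutOp G) : Prop :=
  AddSubgroup.closure {x : G | ∃ N i, i < γ F N ∧ x = g F N i - g F N 0} = ⊤

/-- For every `N`, `(1,0)` is in the integer span of the `t_{N,i}`, `0 ≤ i ≤ γ_N - 2`, and the
`c_{M,i}`, `M ≥ 0`, `0 ≤ i ≤ γ_{M+1} - 2`. -/
def SpanCondition (F : ℕ → CutOp G) : Prop :=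
  ∀ N : ℕ, ((1, 0) : ℤ × G) ∈ AddSubgroup.closure
    ({v | ∃ i, i + 2 ≤ γ F N ∧ v = t F N i} ∪
      {v | ∃ M i, i + 2 ≤ γ F (M + 1) ∧ v = c F M i})

/-- The columns `C_{N,a}` have `h_N` levels. -/
theorem length_column (F : ℕ → CutOp G) (N : ℕ) (a : G) :
    (column F N a).length = height F N := by
  induction N generalizing a with
  | zero => rfl
  | succ N ih =>
    simp only [column, height, List.length_flatMap, List.length_append, List.length_map, ih,
      List.length_range]
    have key : ∀ n : ℕ, ((List.range n).map fun i => height F N + s F N i).sum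
        = n * height F N + ∑ i ∈ Finset.range n, s F N i := by
      intro n
      induction n with
      | zero => simp
      | succ n ihn =>
        rw [List.range_succ, List.map_append, List.sum_append, ihn, Finset.sum_range_succ]
        simp only [List.map_cons, List.map_nil, List.sum_cons, List.sum_nil]
        ring
    exact key _

end CutStack

end

/-!
A level is recorded by its address `(j, -a) : ℤ × G`, for the `j`-th level of the column with
index `a`. Passing to the `i`-th subinterval adds a vector `pieceShift F N i` that does not depend
on the level, and `T` adds `(1, 0)` as long as the result is still an address.

Necessity: `t F M i` lies in `spanGroup F N` for all `M ≥ N`, since `t F (M + 1) i` equals `c F M i`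
modulo the span of the `t F M k`. Hence the address of a point modulo `spanGroup F N` is independent
of the generation up to normalization, and `T` increases it by `(1, 0)`; ergodicity of all powers
of `T` then forces `(1, 0)` into `spanGroup F N`. The same argument with the second coordinate only
gives condition 1.

Sufficiency: by Lebesgue density, sets of positive measure nearly fill products of levels, and
those meet if the addresses agree up to iterates of the transformation. By recurrence, a string of
operations of length `L` occurs in a later generation where the sets fill the levels up to an
error far below the measure of a subinterval `L` generations later, so we may pass to arbitrary
subintervals. Doing so in two generations with the same operations but different heights, the height
differences are absorbed by a common number of iterations; what remains translates single
coordinates by differences of excesses, and these generate all `c F M i`. Conditions 1 and 2 imply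
that every vector is a `c`-combination up to a bounded displacement.
-/

noncomputable section

namespace CutStack

theorem sum_range_add_inj {f : ℕ → ℕ} {i i' j j' : ℕ} (hj : j < f i) (hj' : j' < f i')
    (h : (∑ k ∈ Finset.range i, f k) + j = (∑ k ∈ Finset.range i', f k) + j') :
    i = i' ∧ j = j' := by
  have sum_add_lt {a b c : ℕ} (hc : c < f a) (hab : a < b) :
      (∑ k ∈ Finset.range a, f k) + c < ∑ k ∈ Finset.range b, f k := by
    have := Finset.sum_le_sum_of_subset (f := f) (Finset.range_mono (Nat.succ_le_of_lt hab))
    rw [Nat.succ_eq_add_one, Finset.sum_range_succ] at this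
    omega
  rcases lt_trichotomy i i' with hi | rfl | hi
  · have := sum_add_lt hj hi
    omega
  · exact ⟨rfl, by omega⟩
  · have := sum_add_lt hj' hi
    omega

theorem exists_sum_range_add_eq {f : ℕ → ℕ} {m n : ℕ} (hm : m < ∑ k ∈ Finset.range n, f k) :
    ∃ i < n, ∃ j < f i, m = (∑ k ∈ Finset.range i, f k) + j := by
  induction n with
  | zero => simp at hm
  | succ n ih =>
    by_cases h : m < ∑ k ∈ Finset.range n, f k
    · obtain ⟨i, hi, hj⟩ := ih h
      exact ⟨i, hi.trans n.lt_succ_self, hj⟩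
    · rw [Finset.sum_range_succ] at hm
      exact ⟨n, n.lt_succ_self, m - ∑ k ∈ Finset.range n, f k, by omega, by omega⟩

theorem length_flatMap_range {α : Type*} (f : ℕ → List α) (n : ℕ) :
    ((List.range n).flatMap f).length = ∑ k ∈ Finset.range n, (f k).length := by
  induction n with
  | zero => rfl
  | succ n ih =>
    rw [List.range_succ, List.flatMap_append, List.length_append, ih, Finset.sum_range_succ,
      List.flatMap_singleton]

theorem getElem?_flatMap_range {α : Type*} (f : ℕ → List α) {n i j : ℕ} (hi : i < n)
    (hj : j < (f i).length) :
    ((List.range n).flatMap f)[(∑ k ∈ Finset.range i, (f k).length) + j]? = (f i)[j]? := by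
  induction n with
  | zero => omega
  | succ n ih =>
    rw [List.range_succ, List.flatMap_append, List.flatMap_singleton]
    rcases Nat.lt_succ_iff_lt_or_eq.1 hi with h | rfl
    · rw [List.getElem?_append_left, ih h]
      have := Finset.sum_le_sum_of_subset (f := fun k => (f k).length)
        (Finset.range_mono (Nat.succ_le_of_lt h))
      rw [Nat.succ_eq_add_one, Finset.sum_range_succ] at this
      rw [length_flatMap_range]
      omega
    · rw [List.getElem?_append_right (by rw [length_flatMap_range]; omega), length_flatMap_range,
        Nat.add_sub_cancel_left]

theorem infix_pair_iff {α : Type*} {p q : α} {l : List α} :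
    [p, q] <:+: l ↔ ∃ j, l[j]? = some p ∧ l[j + 1]? = some q := by
  constructor
  · rintro ⟨l₁, l₂, rfl⟩
    exact ⟨l₁.length, by simp, by simp⟩
  · rintro ⟨j, hp, hq⟩
    obtain ⟨hj, rfl⟩ := List.getElem?_eq_some_iff.1 hp
    obtain ⟨hj', rfl⟩ := List.getElem?_eq_some_iff.1 hq
    refine ⟨l.take j, l.drop (j + 2), ?_⟩
    rw [List.append_assoc, List.cons_append, List.cons_append, List.nil_append,
      List.cons_getElem_drop_succ, List.cons_getElem_drop_succ, List.take_append_drop]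

theorem exists_nat_mul_add_eq {w y : ℝ} (hw : 0 < w) {n : ℕ} (hy : y ∈ Set.Ico 0 (n * w)) :
    ∃ i < n, ∃ u ∈ Set.Ico 0 w, y = i * w + u := by
  have hdiv : 0 ≤ y / w := div_nonneg hy.1 hw.le
  have hle := (le_div_iff₀ hw).1 (Nat.floor_le hdiv)
  have hlt := (div_lt_iff₀ hw).1 (Nat.lt_floor_add_one (y / w))
  refine ⟨⌊y / w⌋₊, ?_, y - ⌊y / w⌋₊ * w, ⟨by linarith, by linarith⟩, by ring⟩
  exact (Nat.floor_lt hdiv).2 ((div_lt_iff₀ hw).2 hy.2)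

theorem nat_mul_add_inj {w u u' : ℝ} {i i' : ℕ} (hu : u ∈ Set.Ico 0 w) (hu' : u' ∈ Set.Ico 0 w)
    (h : i * w + u = i' * w + u') : i = i' ∧ u = u' := by
  have hw : 0 < w := hu.1.trans_lt hu.2
  have h₁ : (i : ℝ) < i' + 1 := lt_of_mul_lt_mul_right (by linarith [hu.1, hu'.2]) hw.le
  have h₂ : (i' : ℝ) < i + 1 := lt_of_mul_lt_mul_right (by linarith [hu.2, hu'.1]) hw.le
  norm_cast at h₁ h₂
  obtain rfl : i = i' := by omega
  exact ⟨rfl, by linarith⟩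

theorem nat_mul_add_mem_Ico {w u : ℝ} {i n : ℕ} (hi : i < n) (hu : u ∈ Set.Ico 0 w) :
    i * w + u ∈ Set.Ico 0 (n * w) := by
  have hw : 0 ≤ w := hu.1.trans hu.2.le
  have : ((i + 1 : ℕ) : ℝ) * w ≤ n * w := by gcongr; exact hi
  push_cast at this
  exact ⟨add_nonneg (by positivity) hu.1, by linarith [hu.2]⟩

section Parameters

variable {G : Type*} (F : ℕ → CutOp G) (N : ℕ)

theorem one_lt_γ : 1 < γ F N := (F N).one_lt_cuts

theorem γ_pos : 0 < γ F N := one_pos.trans (one_lt_γ F N)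

theorem height_pos : 0 < height F N := by
  induction N with
  | zero => exact one_pos
  | succ N ih => exact Nat.add_pos_left (Nat.mul_pos (γ_pos F N) ih) _

theorem width_pos : 0 < width F N := by
  induction N with
  | zero => exact one_pos
  | succ N ih => exact div_pos ih (Nat.cast_pos.2 (γ_pos F N))

theorem γ_mul_width_succ : (γ F N : ℝ) * width F (N + 1) = width F N :=
  mul_div_cancel₀ _ (Nat.cast_ne_zero.2 (γ_pos F N).ne')

theorem height_succ_mul_width_succ : (height F (N + 1) : ℝ) * width F (N + 1) =
    height F N * width F N + (∑ k ∈ Finset.range (γ F N), s F N k : ℕ) * width F (N + 1) := by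
  rw [height, ← γ_mul_width_succ F N, Nat.cast_add, Nat.cast_mul]
  ring

/-- The position in a column of generation `N + 1` of the first level cut from the `i`-th
subintervals of a column of generation `N`. -/
def blockStart (i : ℕ) : ℕ := ∑ k ∈ Finset.range i, (height F N + s F N k)

theorem blockStart_one : blockStart F N 1 = height F N + s F N 0 := by
  simp [blockStart]

theorem blockStart_succ (i : ℕ) :
    blockStart F N (i + 1) = blockStart F N i + (height F N + s F N i) :=
  Finset.sum_range_succ _ i

theorem blockStart_γ : blockStart F N (γ F N) = height F (N + 1) := by
  simp [blockStart, Finset.sum_add_distrib, height]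

theorem blockStart_mono : Monotone (blockStart F N) :=
  monotone_nat_of_le_succ fun i => by rw [blockStart_succ]; omega

theorem blockStart_add_le {i : ℕ} (hi : i < γ F N) :
    blockStart F N i + (height F N + s F N i) ≤ height F (N + 1) := by
  rw [← blockStart_succ, ← blockStart_γ]
  exact blockStart_mono F N hi

theorem height_strictMono : StrictMono (height F) := by
  refine strictMono_nat_of_lt_succ fun N => ?_
  have h := blockStart_add_le F N (one_lt_γ F N)
  have := height_pos F N
  rw [blockStart_one] at h
  omega

/-- A level of generation `N` is addressed by `z = (j, -a)`, where `j` is its position in the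
column with index `a`. The sign makes passing to a subinterval a translation of addresses. -/
def IsAddress (z : ℤ × G) : Prop := 0 ≤ z.1 ∧ z.1 < height F N

variable {F} in
theorem isAddress_zero_iff {z : ℤ × G} : IsAddress F 0 z ↔ z.1 = 0 := by
  simp only [IsAddress, height]
  omega

end Parameters

section Address

variable {G : Type*} [AddCommGroup G] (F : ℕ → CutOp G) (N : ℕ)

/-- The part of `column F (N + 1) a` consisting of the `i`-th subintervals of a column of
generation `N` and the spacers above them. -/
def block (a : G) (i : ℕ) : List (ℝ × G) :=
  (column F N (a + g F N i)).map (fun p => (p.1 + i * width F (N + 1), p.2)) ++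
    (List.range (s F N i)).map (fun (j : ℕ) =>
      (height F N * width F N
        + ((∑ k ∈ Finset.range i, s F N k : ℕ) + j) * width F (N + 1), a))

theorem length_block (a : G) (i : ℕ) : (block F N a i).length = height F N + s F N i := by
  simp [block, length_column]

variable {F N} in
theorem getElem?_column_succ {a : G} {i j : ℕ} (hi : i < γ F N) (hj : j < height F N + s F N i) :
    (column F (N + 1) a)[blockStart F N i + j]? = (block F N a i)[j]? := by
  have h := getElem?_flatMap_range (block F N a) hi (hj.trans_eq (length_block F N a i).symm)
  simp only [length_block] at h
  exact h

/-- The entry, in its column, of the level with address `z`; it is `(0, 0)` if there is no such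
level. -/
def entry (z : ℤ × G) : ℝ × G := ((column F N (-z.2))[z.1.toNat]?).getD (0, 0)

/-- The translation taking the address of a level of generation `N` to the address of its `i`-th
subinterval. -/
def pieceShift (i : ℕ) : ℤ × G := (blockStart F N i, g F N i)

variable {F N}

theorem IsAddress.getElem?_column {z : ℤ × G} (hz : IsAddress F N z) :
    (column F N (-z.2))[z.1.toNat]? = some (entry F N z) := by
  have : z.1.toNat < (column F N (-z.2)).length := by
    rw [length_column]
    have := hz.1
    have := hz.2
    omega
  simp [entry, this]

theorem isAddress_of_getElem? {a : G} {j : ℕ} {p : ℝ × G} (h : (column F N a)[j]? = some p) :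
    IsAddress F N (j, -a) := by
  obtain ⟨hj, -⟩ := List.getElem?_eq_some_iff.1 h
  rw [length_column] at hj
  exact ⟨Int.natCast_nonneg j, Int.ofNat_lt.2 hj⟩

theorem entry_of_getElem? {a : G} {j : ℕ} {p : ℝ × G} (h : (column F N a)[j]? = some p) :
    entry F N (j, -a) = p := by
  simp [entry, h]

theorem entry_zero {z : ℤ × G} (hz : IsAddress F 0 z) : entry F 0 z = (0, -z.2) := by
  simp [entry, column, isAddress_zero_iff.1 hz]

theorem IsAddress.add_pieceShift {z : ℤ × G} (hz : IsAddress F N z) {i : ℕ} (hi : i < γ F N) :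
    IsAddress F (N + 1) (z + pieceShift F N i) := by
  have h := blockStart_add_le F N hi
  obtain ⟨h₁, h₂⟩ := hz
  simp only [IsAddress, pieceShift, Prod.fst_add]
  omega

theorem entry_add_pieceShift {z : ℤ × G} (hz : IsAddress F N z) {i : ℕ} (hi : i < γ F N) :
    entry F (N + 1) (z + pieceShift F N i) =
      ((entry F N z).1 + i * width F (N + 1), (entry F N z).2) := by
  have hpos : (z + pieceShift F N i).1.toNat = blockStart F N i + z.1.toNat := by
    have := hz.1
    simp only [pieceShift, Prod.fst_add]
    omega
  have hcol : -(z + pieceShift F N i).2 + g F N i = -z.2 := by simp [pieceShift]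
  have hlt : z.1.toNat < height F N := by
    have := hz.1
    have := hz.2
    omega
  rw [entry, hpos, getElem?_column_succ hi (by omega), block,
    List.getElem?_append_left (by simpa [length_column] using hlt), List.getElem?_map, hcol,
    hz.getElem?_column]
  rfl

theorem entry_spacer {i j : ℕ} (hi : i < γ F N) (hj : j < s F N i) (b : G) :
    entry F (N + 1) (blockStart F N i + (height F N + j), b) =
      (height F N * width F N + ((∑ k ∈ Finset.range i, s F N k) + j : ℕ) * width F (N + 1),
        -b) := by
  have hpos : ((blockStart F N i : ℤ) + (height F N + j)).toNat
      = blockStart F N i + (height F N + j) := by omega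
  rw [entry, hpos, getElem?_column_succ hi (by omega), block,
    List.getElem?_append_right (by simp [length_column])]
  simp [length_column, hj]

theorem IsAddress.cases_succ {z : ℤ × G} (hz : IsAddress F (N + 1) z) :
    (∃ i < γ F N, ∃ z', IsAddress F N z' ∧ z = z' + pieceShift F N i) ∨
      ∃ i < γ F N, ∃ j < s F N i, ∃ b, z = ((blockStart F N i : ℤ) + (height F N + j), b) := by
  obtain ⟨h₀, h₁⟩ := hz
  rw [← blockStart_γ] at h₁
  obtain ⟨i, hi, j, hj, hij⟩ := exists_sum_range_add_eq (m := z.1.toNat)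
    (f := fun k => height F N + s F N k) (n := γ F N) ((Int.toNat_lt h₀).2 h₁)
  rw [← blockStart] at hij
  by_cases h : j < height F N
  · refine .inl ⟨i, hi, z - pieceShift F N i, ?_, by simp⟩
    simp only [IsAddress, pieceShift, Prod.fst_sub]
    omega
  · exact .inr ⟨i, hi, j - height F N, by omega, z.2, Prod.ext (by omega) rfl⟩

theorem entry_fst_add_width_le {z : ℤ × G} (hz : IsAddress F N z) :
    (entry F N z).1 + width F N ≤ height F N * width F N := by
  induction N generalizing z with
  | zero => simp [entry_zero hz, height]
  | succ N ih =>
    have hw := width_pos F (N + 1)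
    have hγ := γ_mul_width_succ F N
    rw [height_succ_mul_width_succ]
    rcases hz.cases_succ with ⟨i, hi, z, hz', rfl⟩ | ⟨i, hi, j, hj, b, rfl⟩
    · have hcut : ((i + 1 : ℕ) : ℝ) * width F (N + 1) ≤ γ F N * width F (N + 1) := by
        gcongr
        exact hi
      have hspacers :
          0 ≤ ((∑ k ∈ Finset.range (γ F N), s F N k : ℕ) : ℝ) * width F (N + 1) := by positivity
      rw [entry_add_pieceShift hz' hi]
      push_cast at hcut hspacers ⊢
      linarith [ih hz']
    · have hle : (∑ k ∈ Finset.range i, s F N k) + j + 1 ≤ ∑ k ∈ Finset.range (γ F N), s F N k :=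
        calc _ ≤ ∑ k ∈ Finset.range (i + 1), s F N k := by rw [Finset.sum_range_succ]; omega
          _ ≤ _ := Finset.sum_le_sum_of_subset (Finset.range_mono hi)
      have hle' : (((∑ k ∈ Finset.range i, s F N k) + j + 1 : ℕ) : ℝ) * width F (N + 1) ≤
          (∑ k ∈ Finset.range (γ F N), s F N k : ℕ) * width F (N + 1) := by gcongr
      rw [entry_spacer hi hj]
      push_cast at hle' ⊢
      linarith

end Address

section Subdivision

variable {G : Type*} (F : ℕ → CutOp G)

/-- The number of subintervals of generation `N + r` of a level of generation `N`. -/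
def pieces (N r : ℕ) : ℕ := ∏ i ∈ Finset.range r, γ F (N + i)

/-- The distance from the left end of a level of generation `N` to the left end of its `p`-th
subinterval of generation `N + r`. Subintervals are numbered in the order in which they appear in a
column of generation `N + r`: the digit of `p` for the cut of generation `N` is the least
significant one. -/
def offset : ℕ → ℕ → ℕ → ℝ
  | _, 0, _ => 0
  | N, r + 1, p => (p % γ F N : ℕ) * width F (N + 1) + offset (N + 1) r (p / γ F N)

theorem pieces_succ (N r : ℕ) : pieces F N (r + 1) = γ F N * pieces F (N + 1) r := by
  rw [pieces, Finset.prod_range_succ', mul_comm, pieces]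
  simp only [add_zero, add_assoc, add_comm 1]

theorem lt_pieces (N r : ℕ) : r < pieces F N r :=
  calc r < 2 ^ r := Nat.lt_two_pow_self
    _ = ∏ i ∈ Finset.range r, 2 := by simp
    _ ≤ pieces F N r := Finset.prod_le_prod' fun i _ => one_lt_γ F (N + i)

theorem tendsto_width : Filter.Tendsto (width F) Filter.atTop (nhds 0) := by
  have width_le (N : ℕ) : width F N ≤ (1 / 2 : ℝ) ^ N := by
    induction N with
    | zero => exact le_rfl
    | succ N ih =>
      have h : (2 : ℝ) ≤ γ F N := mod_cast one_lt_γ F N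
      have hw := width_pos F (N + 1)
      have : 2 * width F (N + 1) ≤ width F N := by
        rw [← γ_mul_width_succ F N]
        gcongr
      rw [pow_succ]
      linarith
  exact squeeze_zero (fun N => (width_pos F N).le) width_le
    (tendsto_pow_atTop_nhds_zero_of_lt_one (by norm_num) (by norm_num))

variable {F}

theorem offset_add_mem_Ico {N r : ℕ} (p : ℕ) {u : ℝ} (hu : u ∈ Set.Ico 0 (width F (N + r))) :
    offset F N r p + u ∈ Set.Ico 0 (width F N) := by
  induction r generalizing N p with
  | zero => simpa [offset] using hu
  | succ r ih =>
    rw [← Nat.add_assoc, Nat.add_right_comm] at hu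
    rw [offset, add_assoc, ← γ_mul_width_succ F N]
    exact nat_mul_add_mem_Ico (Nat.mod_lt p (γ_pos F N)) (ih _ hu)

theorem exists_offset_add_eq (N r : ℕ) {u : ℝ} (hu : u ∈ Set.Ico 0 (width F N)) :
    ∃ p < pieces F N r, ∃ u' ∈ Set.Ico 0 (width F (N + r)), u = offset F N r p + u' := by
  induction r generalizing N u with
  | zero => exact ⟨0, lt_pieces F N 0, u, hu, (zero_add u).symm⟩
  | succ r ih =>
    rw [← γ_mul_width_succ F N] at hu
    obtain ⟨i, hi, u, hu', rfl⟩ := exists_nat_mul_add_eq (width_pos F (N + 1)) hu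
    obtain ⟨p, hp, v, hv, rfl⟩ := ih (N + 1) hu'
    refine ⟨i + γ F N * p, ?_, v, by rwa [← Nat.add_assoc, Nat.add_right_comm], ?_⟩
    · calc i + γ F N * p < γ F N * (p + 1) := by rw [Nat.mul_succ]; omega
        _ ≤ pieces F N (r + 1) := by rw [pieces_succ]; gcongr; exact hp
    · rw [offset, Nat.add_mul_mod_self_left, Nat.mod_eq_of_lt hi,
        Nat.add_mul_div_left _ _ (γ_pos F N), Nat.div_eq_of_lt hi, zero_add, add_assoc]

end Subdivision

section Point

variable {G : Type*} [AddCommGroup G] (F : ℕ → CutOp G) (N : ℕ)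

/-- The point at distance `u` from the left end of the level with address `z`. -/
def point (z : ℤ × G) (u : ℝ) : ℝ × G := ((entry F N z).1 + u, (entry F N z).2)

/-- The translation taking the address of a level of generation `N` to the address of its `p`-th
subinterval of generation `N + r`, in the numbering of `offset`. -/
def descShift : ℕ → ℕ → ℕ → ℤ × G
  | _, 0, _ => 0
  | N, r + 1, p => pieceShift F N (p % γ F N) + descShift (N + 1) r (p / γ F N)

variable {F N}

theorem mem_level_entry_iff {z : ℤ × G} {x : ℝ × G} :
    x ∈ level F N (entry F N z) ↔ ∃ u ∈ Set.Ico 0 (width F N), x = point F N z u := by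
  constructor
  · rintro ⟨⟨h₁, h₂⟩, h₃⟩
    exact ⟨x.1 - (entry F N z).1, ⟨by linarith, by linarith⟩, Prod.ext (by simp [point]) h₃⟩
  · rintro ⟨u, ⟨h₁, h₂⟩, rfl⟩
    exact ⟨⟨by simpa [point] using h₁, by simpa [point] using h₂⟩, rfl⟩

theorem mem_space_iff {x : ℝ × G} : x ∈ space F ↔
    ∃ N z, IsAddress F N z ∧ ∃ u ∈ Set.Ico 0 (width F N), x = point F N z u := by
  constructor
  · rintro ⟨N, a, p, hp, hx⟩
    obtain ⟨j, hj⟩ := List.mem_iff_getElem?.1 hp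
    rw [← entry_of_getElem? hj, mem_level_entry_iff] at hx
    exact ⟨N, _, isAddress_of_getElem? hj, hx⟩
  · rintro ⟨N, z, hz, hx⟩
    exact ⟨N, _, _, List.mem_of_getElem? hz.getElem?_column, mem_level_entry_iff.2 hx⟩

theorem point_add_pieceShift {z : ℤ × G} (hz : IsAddress F N z) {i : ℕ} (hi : i < γ F N)
    (u : ℝ) :
    point F (N + 1) (z + pieceShift F N i) u = point F N z (i * width F (N + 1) + u) := by
  rw [point, entry_add_pieceShift hz hi, point, add_assoc]

theorem IsAddress.add_descShift {z : ℤ × G} (hz : IsAddress F N z) (r p : ℕ) :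
    IsAddress F (N + r) (z + descShift F N r p) := by
  induction r generalizing N z p with
  | zero => simpa [descShift] using hz
  | succ r ih =>
    rw [descShift, ← Nat.add_assoc, Nat.add_right_comm, ← add_assoc]
    exact ih (hz.add_pieceShift (Nat.mod_lt p (γ_pos F N))) _

theorem point_add_descShift {z : ℤ × G} (hz : IsAddress F N z) (r p : ℕ) (u : ℝ) :
    point F (N + r) (z + descShift F N r p) u = point F N z (offset F N r p + u) := by
  induction r generalizing N z p with
  | zero => simp [descShift, offset]
  | succ r ih =>
    have hi := Nat.mod_lt p (γ_pos F N)
    rw [descShift, ← Nat.add_assoc, Nat.add_right_comm, ← add_assoc, ih (hz.add_pieceShift hi),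
      point_add_pieceShift hz hi, offset, add_assoc]

theorem point_ne_point_spacer {z : ℤ × G} {i j : ℕ} {b : G} {u u' : ℝ} (hz : IsAddress F N z)
    (hu : u < width F N) (hi : i < γ F N) (hj : j < s F N i) (hu' : 0 ≤ u') :
    point F N z u ≠ point F (N + 1) (blockStart F N i + (height F N + j), b) u' := by
  intro h
  have hfst := congrArg Prod.fst h
  simp only [point, entry_spacer hi hj] at hfst
  have hw := width_pos F (N + 1)
  have : (0 : ℝ) ≤ ((∑ k ∈ Finset.range i, s F N k) + j : ℕ) * width F (N + 1) := by positivity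
  linarith [entry_fst_add_width_le hz]

theorem point_spacer_inj {i i' j j' : ℕ} {b b' : G} {u u' : ℝ} (hi : i < γ F N)
    (hi' : i' < γ F N) (hj : j < s F N i) (hj' : j' < s F N i')
    (hu : u ∈ Set.Ico 0 (width F (N + 1))) (hu' : u' ∈ Set.Ico 0 (width F (N + 1)))
    (h : point F (N + 1) (blockStart F N i + (height F N + j), b) u =
      point F (N + 1) (blockStart F N i' + (height F N + j'), b') u') :
    (i = i' ∧ j = j') ∧ b = b' ∧ u = u' := by
  rw [point, point, entry_spacer hi hj, entry_spacer hi' hj', Prod.mk.injEq, add_assoc, add_assoc,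
    add_right_inj, neg_inj] at h
  obtain ⟨hij, rfl⟩ := nat_mul_add_inj hu hu' h.1
  exact ⟨sum_range_add_inj hj hj' hij, h.2, rfl⟩

theorem point_inj {z z' : ℤ × G} {u u' : ℝ} (hz : IsAddress F N z) (hz' : IsAddress F N z')
    (hu : u ∈ Set.Ico 0 (width F N)) (hu' : u' ∈ Set.Ico 0 (width F N))
    (h : point F N z u = point F N z' u') : z = z' ∧ u = u' := by
  induction N generalizing z z' u u' with
  | zero =>
    rw [point, point, entry_zero hz, entry_zero hz', Prod.mk.injEq, zero_add, zero_add,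
      neg_inj] at h
    rw [isAddress_zero_iff] at hz hz'
    exact ⟨Prod.ext (hz.trans hz'.symm) h.2, h.1⟩
  | succ N ih =>
    rcases hz.cases_succ with ⟨i, hi, y, hy, rfl⟩ | ⟨i, hi, j, hj, b, rfl⟩ <;>
    rcases hz'.cases_succ with ⟨i', hi', y', hy', rfl⟩ | ⟨i', hi', j', hj', b', rfl⟩
    · rw [point_add_pieceShift hy hi, point_add_pieceShift hy' hi'] at h
      have hv := nat_mul_add_mem_Ico hi hu
      have hv' := nat_mul_add_mem_Ico hi' hu'
      rw [γ_mul_width_succ] at hv hv'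
      obtain ⟨rfl, hvv'⟩ := ih hy hy' hv hv' h
      obtain ⟨rfl, rfl⟩ := nat_mul_add_inj hu hu' hvv'
      exact ⟨rfl, rfl⟩
    · have hv := nat_mul_add_mem_Ico hi hu
      rw [point_add_pieceShift hy hi] at h
      rw [γ_mul_width_succ] at hv
      exact (point_ne_point_spacer hy hv.2 hi' hj' hu'.1 h).elim
    · have hv' := nat_mul_add_mem_Ico hi' hu'
      rw [point_add_pieceShift hy' hi'] at h
      rw [γ_mul_width_succ] at hv'
      exact (point_ne_point_spacer hy' hv'.2 hi hj hu.1 h.symm).elim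
    · obtain ⟨⟨rfl, rfl⟩, rfl, rfl⟩ := point_spacer_inj hi hi' hj hj' hu hu' h
      exact ⟨rfl, rfl⟩

theorem exists_point_eq_of_le {M : ℕ} (hM : N ≤ M) {z : ℤ × G} (hz : IsAddress F N z) {u : ℝ}
    (hu : u ∈ Set.Ico 0 (width F N)) :
    ∃ z', IsAddress F M z' ∧ ∃ u' ∈ Set.Ico 0 (width F M), point F M z' u' = point F N z u := by
  obtain ⟨r, rfl⟩ := Nat.exists_eq_add_of_le hM
  obtain ⟨p, -, u, hu', rfl⟩ := exists_offset_add_eq N r hu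
  exact ⟨_, hz.add_descShift r p, u, hu', point_add_descShift hz r p u⟩

theorem IsAddress.add_descShift_add_one {z : ℤ × G} (hz : IsAddress F N z) {r p : ℕ}
    (h : offset F N r p + width F (N + r) < width F N) :
    IsAddress F (N + r) (z + descShift F N r p + (1, 0)) := by
  induction r generalizing N z p with
  | zero => exact absurd h (by simp [offset])
  | succ r ih =>
    have hi := Nat.mod_lt p (γ_pos F N)
    rw [descShift, ← Nat.add_assoc, Nat.add_right_comm, ← add_assoc]
    rw [offset, ← Nat.add_assoc, Nat.add_right_comm] at h
    rcases (Nat.succ_le_of_lt hi).eq_or_lt with hlast | hlt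
    · refine ih (hz.add_pieceShift hi) ?_
      have hlast' : ((p % γ F N : ℕ) + 1 : ℝ) = γ F N := mod_cast hlast
      rw [← γ_mul_width_succ F N, ← hlast'] at h
      linarith
    · have hnext : IsAddress F (N + 1) (z + pieceShift F N (p % γ F N) + (1, 0)) := by
        have hle := blockStart_add_le F N hlt
        have hpos := height_pos F N
        rw [Nat.succ_eq_add_one, blockStart_succ] at hle
        obtain ⟨h₁, h₂⟩ := hz
        simp only [IsAddress, pieceShift, Prod.fst_add]
        omega
      rw [add_right_comm (z + _)]
      exact hnext.add_descShift _ _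

theorem exists_point_eq_add_one {z : ℤ × G} (hz : IsAddress F N z) {u : ℝ}
    (hu : u ∈ Set.Ico 0 (width F N)) :
    ∃ M ≥ N, ∃ z', IsAddress F M z' ∧ IsAddress F M (z' + (1, 0)) ∧
      ∃ u' ∈ Set.Ico 0 (width F M), point F M z' u' = point F N z u := by
  obtain ⟨M, hM, hNM⟩ := (((tendsto_width F).eventually_lt_const (sub_pos.2 hu.2)).and
    (Filter.eventually_ge_atTop N)).exists
  obtain ⟨r, rfl⟩ := Nat.exists_eq_add_of_le hNM
  obtain ⟨p, -, u, hu', rfl⟩ := exists_offset_add_eq N r hu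
  exact ⟨N + r, hNM, _, hz.add_descShift r p, hz.add_descShift_add_one (by linarith [hu'.1]), u,
    hu', point_add_descShift hz r p u⟩

end Point

section Transformation

variable {G : Type*} [AddCommGroup G] {F : ℕ → CutOp G} {N : ℕ}

/-- `Above F x y`, witnessed by a column of generation `N`. -/
def AboveAt (F : ℕ → CutOp G) (N : ℕ) (x y : ℝ × G) : Prop :=
  ∃ z, IsAddress F N z ∧ IsAddress F N (z + (1, 0)) ∧
    ∃ u ∈ Set.Ico 0 (width F N), x = point F N z u ∧ y = point F N (z + (1, 0)) u

theorem above_iff_exists_aboveAt {x y : ℝ × G} : Above F x y ↔ ∃ N, AboveAt F N x y := by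
  constructor
  · rintro ⟨N, a, p, q, hpq, hx, rfl⟩
    obtain ⟨j, hp, hq⟩ := infix_pair_iff.1 hpq
    have hsucc : (((j + 1 : ℕ) : ℤ), -a) = ((j : ℤ), -a) + (1, 0) := by simp
    have hq' := entry_of_getElem? hq
    rw [← entry_of_getElem? hp, mem_level_entry_iff] at hx
    obtain ⟨u, hu, rfl⟩ := hx
    rw [hsucc] at hq'
    refine ⟨N, _, isAddress_of_getElem? hp, hsucc ▸ isAddress_of_getElem? hq, u, hu, rfl, ?_⟩
    rw [point, point, hq', entry_of_getElem? hp]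
    exact Prod.ext (by ring) rfl
  · rintro ⟨N, z, hz, hz', u, hu, rfl, rfl⟩
    refine ⟨N, -z.2, entry F N z, entry F N (z + (1, 0)), ?_, mem_level_entry_iff.2 ⟨u, hu, rfl⟩,
      Prod.ext (by simp only [point]; ring) rfl⟩
    refine infix_pair_iff.2 ⟨_, hz.getElem?_column, ?_⟩
    have h := hz'.getElem?_column
    rwa [Prod.fst_add, Int.toNat_add hz.1 zero_le_one, Prod.snd_add, add_zero] at h

theorem AboveAt.of_le {M : ℕ} (hM : N ≤ M) {x y : ℝ × G} (h : AboveAt F N x y) :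
    AboveAt F M x y := by
  obtain ⟨z, hz, hz', u, hu, rfl, rfl⟩ := h
  obtain ⟨r, rfl⟩ := Nat.exists_eq_add_of_le hM
  obtain ⟨p, -, u, hu', rfl⟩ := exists_offset_add_eq N r hu
  have hshift : z + (1, 0) + descShift F N r p = z + descShift F N r p + (1, 0) :=
    add_right_comm _ _ _
  refine ⟨z + descShift F N r p, hz.add_descShift r p, hshift ▸ hz'.add_descShift r p, u, hu',
    (point_add_descShift hz r p u).symm, ?_⟩
  rw [← hshift, point_add_descShift hz']

theorem AboveAt.right_unique {x y y' : ℝ × G} (h : AboveAt F N x y) (h' : AboveAt F N x y') :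
    y = y' := by
  obtain ⟨z, hz, -, u, hu, rfl, rfl⟩ := h
  obtain ⟨z', hz', -, u', hu', hx, rfl⟩ := h'
  obtain ⟨rfl, rfl⟩ := point_inj hz hz' hu hu' hx
  rfl

theorem AboveAt.left_unique {x x' y : ℝ × G} (h : AboveAt F N x y) (h' : AboveAt F N x' y) :
    x = x' := by
  obtain ⟨z, -, hz, u, hu, rfl, rfl⟩ := h
  obtain ⟨z', -, hz', u', hu', rfl, hy⟩ := h'
  obtain ⟨hzz', rfl⟩ := point_inj hz hz' hu hu' hy
  rw [add_right_cancel hzz']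

theorem T_eq_of_above {x y : ℝ × G} (h : Above F x y) : T F x = y := by
  have hT : Above F x (T F x) := by
    rw [T, dif_pos ⟨y, h⟩]
    exact Exists.choose_spec _
  obtain ⟨N, hN⟩ := above_iff_exists_aboveAt.1 h
  obtain ⟨M, hM⟩ := above_iff_exists_aboveAt.1 hT
  exact (hM.of_le (Nat.le_add_left M N)).right_unique (hN.of_le (Nat.le_add_right N M))

theorem Tinv_eq_of_above {x y : ℝ × G} (h : Above F x y) : Tinv F y = x := by
  have hT : Above F (Tinv F y) y := by
    rw [Tinv, dif_pos ⟨x, h⟩]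
    exact Exists.choose_spec (p := fun x => Above F x y) _
  obtain ⟨N, hN⟩ := above_iff_exists_aboveAt.1 h
  obtain ⟨M, hM⟩ := above_iff_exists_aboveAt.1 hT
  exact (hM.of_le (Nat.le_add_left M N)).left_unique (hN.of_le (Nat.le_add_right N M))

theorem above_point {z : ℤ × G} {u : ℝ} (hz : IsAddress F N z) (hz' : IsAddress F N (z + (1, 0)))
    (hu : u ∈ Set.Ico 0 (width F N)) : Above F (point F N z u) (point F N (z + (1, 0)) u) :=
  above_iff_exists_aboveAt.2 ⟨N, z, hz, hz', u, hu, rfl, rfl⟩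

theorem IsAddress.add_of_add_succ {z : ℤ × G} {n : ℕ} (hz : IsAddress F N z)
    (hz' : IsAddress F N (z + (((n + 1 : ℕ) : ℤ), 0))) : IsAddress F N (z + ((n : ℤ), 0)) := by
  simp only [IsAddress, Prod.fst_add] at *
  omega

theorem above_point_add_succ {z : ℤ × G} {u : ℝ} {n : ℕ} (hz : IsAddress F N z)
    (hz' : IsAddress F N (z + (((n + 1 : ℕ) : ℤ), 0))) (hu : u ∈ Set.Ico 0 (width F N)) :
    Above F (point F N (z + ((n : ℤ), 0)) u) (point F N (z + (((n + 1 : ℕ) : ℤ), 0)) u) := by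
  have hsucc : z + (((n + 1 : ℕ) : ℤ), 0) = z + ((n : ℤ), 0) + (1, 0) := by simp [add_assoc]
  have hn := hz.add_of_add_succ hz'
  rw [hsucc] at hz' ⊢
  exact above_point hn hz' hu

theorem T_iterate_point {z : ℤ × G} {u : ℝ} {n : ℕ} (hz : IsAddress F N z)
    (hz' : IsAddress F N (z + ((n : ℤ), 0))) (hu : u ∈ Set.Ico 0 (width F N)) :
    (T F)^[n] (point F N z u) = point F N (z + ((n : ℤ), 0)) u := by
  induction n with
  | zero => simp [Prod.mk_zero_zero]
  | succ n ih =>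
    rw [Function.iterate_succ_apply', ih (hz.add_of_add_succ hz'),
      T_eq_of_above (above_point_add_succ hz hz' hu)]

theorem Tinv_iterate_point {z : ℤ × G} {u : ℝ} {n : ℕ} (hz : IsAddress F N z)
    (hz' : IsAddress F N (z + ((n : ℤ), 0))) (hu : u ∈ Set.Ico 0 (width F N)) :
    (Tinv F)^[n] (point F N (z + ((n : ℤ), 0)) u) = point F N z u := by
  induction n with
  | zero => simp [Prod.mk_zero_zero]
  | succ n ih =>
    rw [Function.iterate_succ_apply, Tinv_eq_of_above (above_point_add_succ hz hz' hu),
      ih (hz.add_of_add_succ hz')]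

theorem Tpow_iterate_point {z : ℤ × G} {u : ℝ} {k : ℤ} {n : ℕ} (hz : IsAddress F N z)
    (hz' : IsAddress F N (z + (k * n, 0))) (hu : u ∈ Set.Ico 0 (width F N)) :
    (Tpow F k)^[n] (point F N z u) = point F N (z + (k * n, 0)) u := by
  rcases k with m | m
  · rw [Int.ofNat_eq_natCast, ← Nat.cast_mul] at hz' ⊢
    exact (congrFun (Function.iterate_mul (T F) m n).symm _).trans (T_iterate_point hz hz' hu)
  · have hback : z + (Int.negSucc m * n, 0) + ((((m + 1) * n : ℕ) : ℤ), 0) = z := by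
      rw [add_assoc, add_eq_left, Prod.mk_add_mk, Int.negSucc_eq, add_zero, Prod.mk_eq_zero]
      exact ⟨by push_cast; ring, rfl⟩
    have h := Tinv_iterate_point (n := (m + 1) * n) hz' (hback.symm ▸ hz) hu
    rw [hback] at h
    exact (congrFun (Function.iterate_mul (Tinv F) (m + 1) n).symm _).trans h

end Transformation

section LevelMeasure

variable {G : Type*} [MeasurableSpace G] {F : ℕ → CutOp G} {N : ℕ}

theorem measurableSet_level [MeasurableSingletonClass G] (p : ℝ × G) :
    MeasurableSet (level F N p) :=
  measurableSet_Ico.prod (measurableSet_singleton _)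

variable [AddCommGroup G]

theorem measurable_point (z : ℤ × G) : Measurable (point F N z) :=
  (measurable_const_add _).prodMk measurable_const

variable [MeasurableSingletonClass G] [Countable G]

theorem measurableSet_space : MeasurableSet (space F) := by
  have space_eq : space F = ⋃ (N) (z) (_ : IsAddress F N z), level F N (entry F N z) := by
    ext x
    simp only [mem_space_iff, Set.mem_iUnion, mem_level_entry_iff, exists_prop]
  rw [space_eq]
  exact .iUnion fun N => .iUnion fun z => .iUnion fun _ => measurableSet_level _

instance sigmaFinite_μ (F : ℕ → CutOp G) : SigmaFinite (μ F) :=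
  inferInstanceAs (SigmaFinite ((volume.prod Measure.count).restrict (space F)))

theorem restrict_level_entry {z : ℤ × G} (hz : IsAddress F N z) :
    (μ F).restrict (level F N (entry F N z)) =
      (volume.restrict (Set.Ico 0 (width F N))).map (point F N z) := by
  have map_add_left : (volume.restrict (Set.Ico 0 (width F N))).map ((entry F N z).1 + ·) =
      volume.restrict (Set.Ico (entry F N z).1 ((entry F N z).1 + width F N)) := by
    have h := ((measurePreserving_add_left (volume : Measure ℝ) (entry F N z).1).restrict_preimage
      (measurableSet_Ico (a := (entry F N z).1) (b := (entry F N z).1 + width F N))).map_eq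
    rwa [Set.preimage_const_add_Ico, sub_self, add_sub_cancel_left] at h
  have level_subset_space : level F N (entry F N z) ⊆ space F := fun x hx =>
    mem_space_iff.2 ⟨N, z, hz, mem_level_entry_iff.1 hx⟩
  rw [μ, Measure.restrict_restrict_of_subset level_subset_space, level, ← Measure.prod_restrict,
    Measure.restrict_singleton, Measure.count_singleton, one_smul, Measure.prod_dirac,
    ← map_add_left, Measure.map_map (by fun_prop) (by fun_prop)]
  rfl

theorem μ_level_entry_pos {z : ℤ × G} (hz : IsAddress F N z) :
    0 < μ F (level F N (entry F N z)) := by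
  rw [← Measure.restrict_apply_univ, restrict_level_entry hz,
    Measure.map_apply (measurable_point z) .univ]
  simpa using width_pos F N

end LevelMeasure

section Residue

variable {G : Type*} [AddCommGroup G] (F : ℕ → CutOp G)

theorem pieceShift_succ_sub (N i : ℕ) :
    pieceShift F N (i + 1) - pieceShift F N i = t F N i := by
  rw [pieceShift, pieceShift, blockStart_succ, t]
  exact Prod.ext (by simp only [Prod.fst_sub]; push_cast; ring) rfl

theorem pieceShift_sub_zero (N i : ℕ) :
    pieceShift F N i - pieceShift F N 0 = ∑ k ∈ Finset.range i, t F N k := by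
  simp_rw [← pieceShift_succ_sub, Finset.sum_range_sub]

theorem t_succ (N i : ℕ) :
    t F (N + 1) i =
      pieceShift F N (γ F N - 1) - pieceShift F N 0 + t F N 0 + c F N i := by
  have h := blockStart_succ F N (γ F N - 1)
  rw [Nat.sub_add_cancel (γ_pos F N), blockStart_γ] at h
  ext
  · simp only [t, pieceShift, c, Prod.fst_sub, Prod.fst_add, h, blockStart, Finset.range_zero,
      Finset.sum_empty]
    push_cast
    ring
  · simp only [t, pieceShift, c, Prod.snd_sub, Prod.snd_add]
    abel

/-- The group generated by the vectors in the `N`-th instance of `SpanCondition`. -/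
def spanGroup (N : ℕ) : AddSubgroup (ℤ × G) :=
  AddSubgroup.closure ({v | ∃ i, i + 2 ≤ γ F N ∧ v = t F N i} ∪
    {v | ∃ M i, i + 2 ≤ γ F (M + 1) ∧ v = c F M i})

variable {F}

theorem pieceShift_sub_zero_mem {N i : ℕ} {H : AddSubgroup (ℤ × G)}
    (h : ∀ k, k + 2 ≤ γ F N → t F N k ∈ H) (hi : i < γ F N) :
    pieceShift F N i - pieceShift F N 0 ∈ H := by
  rw [pieceShift_sub_zero]
  exact sum_mem fun k hk => h k (by have := Finset.mem_range.1 hk; omega)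

theorem t_mem_spanGroup {N M i : ℕ} (hM : N ≤ M) (hi : i + 2 ≤ γ F M) :
    t F M i ∈ spanGroup F N := by
  induction M, hM using Nat.le_induction generalizing i with
  | base => exact AddSubgroup.subset_closure (.inl ⟨i, hi, rfl⟩)
  | succ M _ ih =>
    rw [t_succ]
    exact add_mem (add_mem
      (pieceShift_sub_zero_mem (fun k hk => ih hk) (Nat.sub_one_lt (γ_pos F M).ne'))
      (ih (one_lt_γ F M))) (AddSubgroup.subset_closure (.inr ⟨M, i, hi, rfl⟩))

theorem pieceShift_sub_zero_mem_spanGroup {N M i : ℕ} (hM : N ≤ M) (hi : i < γ F M) :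
    pieceShift F M i - pieceShift F M 0 ∈ spanGroup F N :=
  pieceShift_sub_zero_mem (fun _ => t_mem_spanGroup hM) hi

variable (F) in
/-- The address in generation `M` of the leftmost subinterval of the level with address `0` of
generation `0`. -/
def base (M : ℕ) : ℤ × G := ∑ m ∈ Finset.range M, pieceShift F m 0

variable (F) in
/-- The address of `x` in generation `M`, relative to `base F M`, is `v` modulo `H`. -/
def HasResidueAt (M : ℕ) (H : AddSubgroup (ℤ × G)) (x : ℝ × G) (v : ℤ × G) : Prop :=
  ∃ z, IsAddress F M z ∧ z - base F M - v ∈ H ∧ ∃ u ∈ Set.Ico 0 (width F M), x = point F M z u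

variable (F) in
/-- `x` has the residue `v` modulo `H` in some generation `M ≥ N`. If `H` contains all
`pieceShift F M i - pieceShift F M 0` with `M ≥ N`, this is then true in all later generations,
so that `x` determines `v` modulo `H`. -/
def HasResidue (N : ℕ) (H : AddSubgroup (ℤ × G)) (x : ℝ × G) (v : ℤ × G) : Prop :=
  ∃ M ≥ N, HasResidueAt F M H x v

variable {N : ℕ} {H : AddSubgroup (ℤ × G)} {x : ℝ × G} {v v' : ℤ × G}

theorem hasResidue_point {M : ℕ} (hM : N ≤ M) {z : ℤ × G} {u : ℝ} (hz : IsAddress F M z)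
    (hu : u ∈ Set.Ico 0 (width F M)) : HasResidue F N H (point F M z u) (z - base F M) :=
  ⟨M, hM, z, hz, by simp only [sub_self, zero_mem], u, hu, rfl⟩

theorem descShift_sub_base_mem
    (hH : ∀ M ≥ N, ∀ i < γ F M, pieceShift F M i - pieceShift F M 0 ∈ H) {M : ℕ} (hM : N ≤ M)
    (r p : ℕ) : descShift F M r p - (base F (M + r) - base F M) ∈ H := by
  induction r generalizing M p with
  | zero => simp [descShift, zero_mem]
  | succ r ih =>
    have hi := hH M hM _ (Nat.mod_lt p (γ_pos F M))
    convert add_mem hi (ih (Nat.le_succ_of_le hM) (p / γ F M)) using 1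
    rw [← Nat.add_assoc, Nat.add_right_comm, descShift, base, base, base,
      Finset.sum_range_succ _ M]
    abel

theorem HasResidueAt.of_le
    (hH : ∀ M ≥ N, ∀ i < γ F M, pieceShift F M i - pieceShift F M 0 ∈ H) {M L : ℕ} (hM : N ≤ M)
    (hL : M ≤ L) (h : HasResidueAt F M H x v) : HasResidueAt F L H x v := by
  obtain ⟨z, hz, hv, u, hu, rfl⟩ := h
  obtain ⟨r, rfl⟩ := Nat.exists_eq_add_of_le hL
  obtain ⟨p, -, u, hu', rfl⟩ := exists_offset_add_eq M r hu
  refine ⟨_, hz.add_descShift r p, ?_, u, hu', (point_add_descShift hz r p u).symm⟩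
  convert add_mem hv (descShift_sub_base_mem hH hM r p) using 1
  abel

theorem HasResidueAt.sub_mem {M : ℕ} (h : HasResidueAt F M H x v)
    (h' : HasResidueAt F M H x v') : v' - v ∈ H := by
  obtain ⟨z, hz, hv, u, hu, rfl⟩ := h
  obtain ⟨z', hz', hv', u', hu', hx⟩ := h'
  obtain ⟨rfl, -⟩ := point_inj hz hz' hu hu' hx
  convert H.sub_mem hv hv' using 1
  abel

theorem HasResidue.sub_mem
    (hH : ∀ M ≥ N, ∀ i < γ F M, pieceShift F M i - pieceShift F M 0 ∈ H)
    (h : HasResidue F N H x v) (h' : HasResidue F N H x v') : v' - v ∈ H := by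
  obtain ⟨M, hM, h⟩ := h
  obtain ⟨M', hM', h'⟩ := h'
  exact (h.of_le hH hM (le_max_left M M')).sub_mem (h'.of_le hH hM' (le_max_right M M'))

theorem HasResidue.T_apply
    (hH : ∀ M ≥ N, ∀ i < γ F M, pieceShift F M i - pieceShift F M 0 ∈ H)
    (h : HasResidue F N H x v) : HasResidue F N H (T F x) (v + (1, 0)) := by
  obtain ⟨L, hL, y, hy, -, u, hu, rfl⟩ := id h
  obtain ⟨M, hM, z, hz, hz', u', hu', hx⟩ := exists_point_eq_add_one hy hu
  rw [← hx] at h ⊢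
  refine ⟨M, hL.trans hM, z + (1, 0), hz', ?_, u', hu', T_eq_of_above (above_point hz hz' hu')⟩
  convert h.sub_mem hH (hasResidue_point (hL.trans hM) hz hu') using 1
  abel

theorem HasResidue.T_iterate
    (hH : ∀ M ≥ N, ∀ i < γ F M, pieceShift F M i - pieceShift F M 0 ∈ H)
    (h : HasResidue F N H x v) (n : ℕ) :
    HasResidue F N H ((T F)^[n] x) (v + n • ((1, 0) : ℤ × G)) := by
  induction n with
  | zero => simpa using h
  | succ n ih =>
    rw [Function.iterate_succ_apply', succ_nsmul, ← add_assoc]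
    exact ih.T_apply hH

end Residue

section Necessity

variable {G : Type*} [AddCommGroup G] [Countable G] [MeasurableSpace G]
  [MeasurableSingletonClass G] {F : ℕ → CutOp G}

theorem IsErgodic.exists_sub_sub_nsmul_mem {N n : ℕ} {H : AddSubgroup (ℤ × G)}
    (hH : ∀ M ≥ N, ∀ i < γ F M, pieceShift F M i - pieceShift F M 0 ∈ H)
    (he : IsErgodic (μ F) (T F)^[n]) {M : ℕ} (hM : N ≤ M) {z z' : ℤ × G}
    (hz : IsAddress F M z) (hz' : IsAddress F M z') :
    ∃ i : ℕ, (z ≠ z' → i ≠ 0) ∧ z - z' - (n * i) • ((1, 0) : ℤ × G) ∈ H := by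
  obtain ⟨i, hi⟩ := he _ _ (measurableSet_level _) (measurableSet_level _)
    (μ_level_entry_pos hz) (μ_level_entry_pos hz')
  obtain ⟨x, hx, hx'⟩ := nonempty_of_measure_ne_zero hi.ne'
  rw [Set.mem_preimage, ← Function.iterate_mul, mem_level_entry_iff] at hx
  obtain ⟨u, hu, hx⟩ := hx
  obtain ⟨u', hu', rfl⟩ := mem_level_entry_iff.1 hx'
  refine ⟨i, fun hne => ?_, ?_⟩
  · rintro rfl
    exact hne (point_inj hz' hz hu' hu hx).1.symm
  · have h' := (hasResidue_point (H := H) hM hz' hu').T_iterate hH (n * i)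
    convert (hx ▸ h').sub_mem hH (hasResidue_point hM hz hu) using 1
    abel

theorem shiftsGenerate_of_isErgodic (he : IsErgodic (μ F) (T F)) : ShiftsGenerate F := by
  rw [ShiftsGenerate, eq_top_iff]
  intro b _
  obtain ⟨i, -, h⟩ := IsErgodic.exists_sub_sub_nsmul_mem (n := 1) (N := 0)
    (H := (AddSubgroup.closure {x : G | ∃ N i, i < γ F N ∧ x = g F N i - g F N 0}).comap
      (AddMonoidHom.snd ℤ G))
    (fun M _ i hi => AddSubgroup.subset_closure ⟨M, i, hi, rfl⟩) he le_rfl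
    (z := (0, b)) (z' := 0) (isAddress_zero_iff.2 rfl) (isAddress_zero_iff.2 rfl)
  simpa using h

/-- Ergodicity of `T` applied to the first two subintervals of a level gives a nonzero multiple
`n • (1, 0)` in the group; then ergodicity of `T^n` applied to two adjacent levels gives
`(1, 0)`. -/
theorem spanCondition_of_totallyErgodic (he : TotallyErgodic F) : SpanCondition F := by
  intro N
  change _ ∈ spanGroup F N
  have hH : ∀ M ≥ N, ∀ i < γ F M, pieceShift F M i - pieceShift F M 0 ∈ spanGroup F N :=
    fun M hM i hi => pieceShift_sub_zero_mem_spanGroup hM hi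
  have addr_zero (M : ℕ) : IsAddress F M 0 := ⟨le_rfl, Int.natCast_pos.2 (height_pos F M)⟩
  have addr_one : IsAddress F (N + 1) (1, 0) :=
    ⟨zero_le_one, Nat.one_lt_cast.2
      (Nat.lt_of_le_of_lt (height_pos F N) (height_strictMono F N.lt_succ_self))⟩
  have shift_ne : 0 + pieceShift F N 1 ≠ 0 + pieceShift F N 0 := fun h => by
    have hfst := congrArg Prod.fst h
    have hpos := height_pos F N
    simp only [zero_add, pieceShift, blockStart, Finset.sum_range_one,
      Finset.sum_range_zero] at hfst
    omega
  obtain ⟨n, hn0, hn⟩ := IsErgodic.exists_sub_sub_nsmul_mem hH (he 1 one_pos) N.le_succ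
    ((addr_zero N).add_pieceShift (one_lt_γ F N)) ((addr_zero N).add_pieceShift (γ_pos F N))
  have hmem : n • ((1, 0) : ℤ × G) ∈ spanGroup F N := by
    convert sub_mem (hH N le_rfl 1 (one_lt_γ F N)) hn using 1
    rw [one_mul]
    abel
  obtain ⟨i, -, hi⟩ := IsErgodic.exists_sub_sub_nsmul_mem hH
    (he n (Nat.pos_of_ne_zero (hn0 shift_ne))) N.le_succ addr_one (addr_zero (N + 1))
  convert add_mem hi (nsmul_mem hmem i) using 1
  rw [mul_nsmul, sub_zero, sub_add_cancel]

end Necessity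

section Density

theorem exists_density_point {Y : Type*} [PseudoMetricSpace Y] [MeasurableSpace Y]
    [BorelSpace Y] [SecondCountableTopology Y] {ν : Measure Y} [IsUnifLocDoublingMeasure ν]
    [IsLocallyFiniteMeasure ν] {C : Set Y} (hC : MeasurableSet C) (h0 : ν C ≠ 0) :
    ∃ x ∈ C, ∀ ε : ENNReal, ε ≠ 0 → ∃ δ > 0, ∀ y r, 0 < r → r < δ →
      x ∈ Metric.closedBall y r →
      ν (Metric.closedBall y r \ C) ≤ ε * ν (Metric.closedBall y r) := by
  have : (ae (ν.restrict C)).NeBot := ae_neBot.2 (mt Measure.restrict_eq_zero.1 h0)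
  obtain ⟨x, hx, hxC⟩ := ((ae_restrict_of_ae
    ((IsUnifLocDoublingMeasure.vitaliFamily ν 1).ae_tendsto_measure_inter_div_of_measurableSet
      hC.compl)).and (ae_restrict_mem hC)).exists
  rw [Set.indicator_of_notMem (Set.notMem_compl_iff.2 hxC)] at hx
  refine ⟨x, hxC, fun ε hε => ?_⟩
  obtain ⟨δ, hδ, h⟩ := (VitaliFamily.eventually_filterAt_iff _).1
    (hx.eventually_le_const (pos_iff_ne_zero.2 hε))
  refine ⟨δ / 2, half_pos hδ, fun y r hr hrδ hxy => ?_⟩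
  have hball : Metric.closedBall y r ⊆ Metric.closedBall x δ :=
    Metric.closedBall_subset_closedBall' (by linarith [Metric.mem_closedBall'.1 hxy])
  have hle := h _ (IsUnifLocDoublingMeasure.closedBall_mem_vitaliFamily_of_dist_le_mul ν
    (by rwa [one_mul]) hr) hball
  rw [Set.sdiff_eq, Set.inter_comm]
  rcases eq_or_ne (ν (Metric.closedBall y r)) 0 with hnull | hne
  · rw [measure_mono_null Set.inter_subset_right hnull]
    exact zero_le
  · exact (ENNReal.div_le_iff_le_mul (.inl hne) (.inr hε)).1 hle

variable {ι : Type*}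

/-- The half-open cube of side `w` with lowest corner `a`. -/
def cube (a : ι → ℝ) (w : ℝ) : Set (ι → ℝ) := Set.univ.pi fun l => Set.Ico (a l) (a l + w)

theorem mem_cube_zero_iff {y : ι → ℝ} {w : ℝ} : y ∈ cube 0 w ↔ ∀ l, y l ∈ Set.Ico 0 w := by
  simp [cube]

theorem measurableSet_cube [Countable ι] (a : ι → ℝ) (w : ℝ) : MeasurableSet (cube a w) :=
  .univ_pi fun _ => measurableSet_Ico

theorem preimage_add_cube (a : ι → ℝ) (w : ℝ) : (a + ·) ⁻¹' cube a w = cube 0 w := by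
  ext y
  simp [cube]

variable [Fintype ι]

theorem volume_cube (a : ι → ℝ) (w : ℝ) :
    volume (cube a w) = ENNReal.ofReal w ^ Fintype.card ι := by
  simp [cube, Real.volume_pi_Ico]

theorem volume_cube_zero_pos {w : ℝ} (hw : 0 < w) : 0 < volume (cube (0 : ι → ℝ) w) := by
  rw [volume_cube]
  exact pos_iff_ne_zero.2 (pow_ne_zero _ (ENNReal.ofReal_pos.2 hw).ne')

theorem volume_cube_ne_top (a : ι → ℝ) (w : ℝ) : volume (cube a w) ≠ ⊤ := by
  rw [volume_cube]
  exact ENNReal.pow_ne_top ENNReal.ofReal_ne_top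

theorem cube_subset_closedBall (a : ι → ℝ) {w : ℝ} (hw : 0 ≤ w) :
    cube a w ⊆ Metric.closedBall (a + fun _ => w / 2) (w / 2) := by
  intro y hy
  refine (dist_pi_le_iff (by linarith)).2 fun l => abs_le.2 ?_
  obtain ⟨h₁, h₂⟩ := hy l trivial
  simp only [Pi.add_apply]
  constructor <;> linarith

theorem exists_cube_density_point {C : Set (ι → ℝ)} (hC : MeasurableSet C)
    (h0 : volume C ≠ 0) :
    ∃ x ∈ C, ∀ ε : ENNReal, ε ≠ 0 → ∃ δ > 0, ∀ a w, 0 < w → w < δ → x ∈ cube a w →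
      volume (cube a w \ C) ≤ ε * volume (cube a w) := by
  obtain ⟨x, hxC, hx⟩ := exists_density_point hC h0
  refine ⟨x, hxC, fun ε hε => ?_⟩
  obtain ⟨δ, hδ, h⟩ := hx ε hε
  refine ⟨δ, hδ, fun a w hw hwδ hxa => ?_⟩
  have hsub := cube_subset_closedBall a hw.le
  calc volume (cube a w \ C) ≤ volume (Metric.closedBall (a + fun _ => w / 2) (w / 2) \ C) :=
        measure_mono (Set.sdiff_subset_sdiff_left hsub)
    _ ≤ ε * volume (Metric.closedBall (a + fun _ => w / 2) (w / 2)) :=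
        h _ _ (half_pos hw) (by linarith) (hsub hxa)
    _ = ε * volume (cube a w) := by
        rw [Real.volume_pi_closedBall _ (half_pos hw).le, volume_cube,
          mul_div_cancel₀ w two_ne_zero, ENNReal.ofReal_pow hw.le]

theorem measure_inter_pos_of_add_lt {Y : Type*} [MeasurableSpace Y] {ν : Measure Y}
    {Q S S' : Set Y} (h : ν (Q \ S) + ν (Q \ S') < ν Q) : 0 < ν (S ∩ S') := by
  refine pos_iff_ne_zero.2 fun h0 => h.not_ge ?_
  calc ν Q ≤ ν ((Q \ S ∪ Q \ S') ∪ S ∩ S') := measure_mono fun x hx => by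
        by_cases hS : x ∈ S <;> by_cases hS' : x ∈ S' <;> simp [hx, hS, hS']
    _ ≤ ν (Q \ S) + ν (Q \ S') + 0 := by
        rw [← h0]
        exact (measure_union_le _ _).trans (by gcongr; exact measure_union_le _ _)
    _ = ν (Q \ S) + ν (Q \ S') := add_zero _

end Density

section Pull

variable {G : Type*} {F : ℕ → CutOp G} {N : ℕ} {ι : Type*}

theorem mapsTo_offset_add (r : ℕ) (p : ι → ℕ) :
    Set.MapsTo ((fun l => offset F N r (p l)) + ·) (cube 0 (width F (N + r)))
      (cube 0 (width F N)) := fun _ hy =>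
  mem_cube_zero_iff.2 fun l => offset_add_mem_Ico (p l) (mem_cube_zero_iff.1 hy l)

theorem exists_piece_volume_sdiff_le [Fintype ι] {C : Set (ι → ℝ)} (hC : MeasurableSet C)
    (hsub : C ⊆ cube 0 (width F N)) (h0 : volume C ≠ 0) {ε : ENNReal} (hε : ε ≠ 0) :
    ∃ K, ∀ r, K ≤ N + r → ∃ p : ι → ℕ,
      volume (cube 0 (width F (N + r)) \ ((fun l => offset F N r (p l)) + ·) ⁻¹' C) ≤
        ε * volume (cube (0 : ι → ℝ) (width F (N + r))) := by
  obtain ⟨x, hx, h⟩ := exists_cube_density_point hC h0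
  obtain ⟨δ, hδ, h⟩ := h ε hε
  obtain ⟨K, hK⟩ :=
    Filter.eventually_atTop.1 ((tendsto_width F).eventually_lt_const hδ)
  refine ⟨K, fun r hr => ?_⟩
  choose p _ u hu hxu using fun l => exists_offset_add_eq N r (mem_cube_zero_iff.1 (hsub hx) l)
  refine ⟨p, ?_⟩
  have hxp : x ∈ cube (fun l => offset F N r (p l)) (width F (N + r)) := fun l _ => by
    rw [hxu l]
    exact ⟨le_add_of_nonneg_right (hu l).1, by gcongr; exact (hu l).2⟩
  have hle := h _ _ (width_pos F (N + r)) (hK _ hr) hxp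
  rwa [← measure_preimage_add volume (fun l => offset F N r (p l)), Set.preimage_sdiff,
    preimage_add_cube, volume_cube, ← volume_cube 0] at hle

variable [AddCommGroup G] {A : Set (ι → ℝ × G)} {z : ι → ℤ × G}

variable (F) in
/-- The part of `A` in the product of the levels with the addresses `z l`, translated to the cube
with lowest corner at the origin. -/
def pull (A : Set (ι → ℝ × G)) (N : ℕ) (z : ι → ℤ × G) : Set (ι → ℝ) :=
  cube 0 (width F N) ∩ (fun y l => point F N (z l) (y l)) ⁻¹' A

theorem pull_add_descShift (hz : ∀ l, IsAddress F N (z l)) (r : ℕ) (p : ι → ℕ) :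
    pull F A (N + r) (fun l => z l + descShift F N r (p l)) =
      cube 0 (width F (N + r)) ∩ ((fun l => offset F N r (p l)) + ·) ⁻¹' pull F A N z := by
  ext y
  simp only [pull, Set.mem_inter_iff, Set.mem_preimage, point_add_descShift (hz _)]
  exact and_congr_right fun hy => (and_iff_right (mapsTo_offset_add r p hy)).symm

theorem exists_forall_mem_level_entry [Finite ι] {x : ι → ℝ × G} (hx : ∀ l, x l ∈ space F) :
    ∃ (N : ℕ) (z : ι → ℤ × G),
      (∀ l, IsAddress F N (z l)) ∧ ∀ l, x l ∈ level F N (entry F N (z l)) := by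
  choose n y hy u hu hxu using fun l => mem_space_iff.1 (hx l)
  obtain ⟨N, hN⟩ := Finite.exists_le n
  choose z hz v hv hzv using fun l => exists_point_eq_of_le (hN l) (hy l) (hu l)
  exact ⟨N, z, hz, fun l => mem_level_entry_iff.2 ⟨v l, hv l, (hxu l).trans (hzv l).symm⟩⟩

theorem measurable_points [MeasurableSpace G] (z : ι → ℤ × G) :
    Measurable fun (y : ι → ℝ) l => point F N (z l) (y l) :=
  measurable_pi_lambda _ fun l => (measurable_point (z l)).comp (measurable_pi_apply l)

theorem measurableSet_pull [MeasurableSpace G] [Countable ι] (hA : MeasurableSet A) (N : ℕ)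
    (z : ι → ℤ × G) : MeasurableSet (pull F A N z) :=
  (measurableSet_cube _ _).inter (measurable_points z hA)

variable [Fintype ι]

theorem volume_cube_sdiff_pull_add_descShift_le (hz : ∀ l, IsAddress F N (z l)) (r : ℕ)
    (p : ι → ℕ) :
    volume (cube 0 (width F (N + r)) \ pull F A (N + r) fun l => z l + descShift F N r (p l)) ≤
      volume (cube 0 (width F N) \ pull F A N z) := by
  rw [pull_add_descShift hz, Set.sdiff_self_inter,
    ← measure_preimage_add volume (fun l => offset F N r (p l)) (cube 0 (width F N) \ _)]
  exact measure_mono fun y hy => ⟨mapsTo_offset_add r p hy.1, hy.2⟩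

variable [MeasurableSpace G] [MeasurableSingletonClass G] [Countable G]

theorem restrict_pi_level_entry (hz : ∀ l, IsAddress F N (z l)) :
    (Measure.pi fun _ : ι => μ F).restrict (Set.univ.pi fun l => level F N (entry F N (z l))) =
      (volume.restrict (cube 0 (width F N))).map fun y l => point F N (z l) (y l) := by
  have : ∀ l, SigmaFinite ((volume.restrict (Set.Ico 0 (width F N))).map (point F N (z l))) :=
    fun l => restrict_level_entry (hz l) ▸ inferInstance
  simp_rw [Measure.restrict_pi_pi, restrict_level_entry (hz _)]
  rw [← Measure.pi_map_pi fun l => (measurable_point (z l)).aemeasurable, cube, volume_pi,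
    Measure.restrict_pi_pi]
  simp only [Pi.zero_apply, zero_add]

theorem measure_inter_pi_level_entry (hz : ∀ l, IsAddress F N (z l)) (hA : MeasurableSet A) :
    (Measure.pi fun _ : ι => μ F) (A ∩ Set.univ.pi fun l => level F N (entry F N (z l))) =
      volume (pull F A N z) := by
  rw [← Measure.restrict_apply hA, restrict_pi_level_entry hz,
    Measure.map_apply (measurable_points z) hA,
    Measure.restrict_apply (measurable_points z hA), pull, Set.inter_comm]

theorem exists_volume_pull_ne_zero (hA : MeasurableSet A)
    (h0 : (Measure.pi fun _ : ι => μ F) A ≠ 0) :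
    ∃ N z, (∀ l, IsAddress F N (z l)) ∧ volume (pull F A N z) ≠ 0 := by
  by_contra! hcon
  have ae_mem_space : ∀ᵐ x ∂(Measure.pi fun _ : ι => μ F), ∀ l, x l ∈ space F :=
    ae_all_iff.2 fun l => Measure.tendsto_eval_ae_ae (ae_restrict_mem measurableSet_space)
  have null_union : (Measure.pi fun _ : ι => μ F) (⋃ (N) (z : ι → ℤ × G)
      (_ : ∀ l, IsAddress F N (z l)),
        A ∩ Set.univ.pi fun l => level F N (entry F N (z l))) = 0 := by
    simp only [measure_iUnion_null_iff]
    exact fun N z hz => (measure_inter_pi_level_entry hz hA).trans (hcon N z hz)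
  refine h0 (measure_mono_null_ae ?_ null_union)
  filter_upwards [ae_mem_space] with x hx hxA
  obtain ⟨N, z, hz, hxz⟩ := exists_forall_mem_level_entry hx
  exact Set.mem_iUnion₂.2 ⟨N, z, Set.mem_iUnion.2 ⟨hz, hxA, fun l _ => hxz l⟩⟩

end Pull

section Congruence

variable {G : Type*} {F : ℕ → CutOp G} {M M' : ℕ}

theorem γ_congr (h : F M = F M') : γ F M = γ F M' := by
  rw [γ, γ, h]

theorem s_congr (h : F M = F M') (i : ℕ) : s F M i = s F M' i := by
  rw [s, s, h]

theorem blockStart_sub_of_eq (h : F M = F M') (i : ℕ) :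
    (blockStart F M' i : ℤ) - blockStart F M i = i * ((height F M' : ℤ) - height F M) := by
  simp only [blockStart, Finset.sum_add_distrib, Finset.sum_const, Finset.card_range, s_congr h,
    smul_eq_mul]
  push_cast
  ring

theorem height_succ_sub_of_eq (h : F M = F M') :
    (height F (M' + 1) : ℤ) - height F (M + 1) = γ F M * ((height F M' : ℤ) - height F M) := by
  rw [← blockStart_γ, ← blockStart_γ, ← γ_congr h, blockStart_sub_of_eq h]

variable [AddCommGroup G]

theorem g_congr (h : F M = F M') (i : ℕ) : g F M i = g F M' i := by
  rw [g, g, h]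

theorem pieceShift_sub_of_eq (h : F M = F M') (i : ℕ) :
    pieceShift F M' i - pieceShift F M i = (i * ((height F M' : ℤ) - height F M), 0) := by
  rw [pieceShift, pieceShift, Prod.mk_sub_mk, blockStart_sub_of_eq h, g_congr h, sub_self]

theorem t_sub_of_eq (h : F M = F M') (i : ℕ) :
    t F M' i - t F M i = ((height F M' : ℤ) - height F M, 0) := by
  simp only [t, s_congr h, g_congr h, Prod.mk_sub_mk, sub_self, add_sub_add_left_eq_sub]

theorem c_congr (h : F M = F M') (h' : F (M + 1) = F (M' + 1)) (i : ℕ) : c F M i = c F M' i := by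
  simp only [c, s_congr h, g_congr h, s_congr h', g_congr h', γ_congr h]

end Congruence

section Displacement

variable {G : Type*} [AddCommGroup G]

/-- The difference between the addresses, in a sufficiently late generation, of the `p`-th and the
`0`-th piece of a level of generation `M`. -/
def displacement (F : ℕ → CutOp G) (M p : ℕ) : ℤ × G :=
  if h : p = 0 then 0
  else
    have := Nat.div_lt_self (Nat.pos_of_ne_zero h) (one_lt_γ F M)
    pieceShift F M (p % γ F M) - pieceShift F M 0 + displacement F (M + 1) (p / γ F M)
termination_by p

variable (F : ℕ → CutOp G) (M : ℕ)

theorem displacement_zero : displacement F M 0 = 0 := by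
  rw [displacement, dif_pos rfl]

theorem displacement_eq (p : ℕ) :
    displacement F M p =
      pieceShift F M (p % γ F M) - pieceShift F M 0 + displacement F (M + 1) (p / γ F M) := by
  rcases eq_or_ne p 0 with rfl | hp
  · simp only [Nat.zero_mod, Nat.zero_div, displacement_zero, sub_self, add_zero]
  · rw [displacement, dif_neg hp]

variable {F M}

theorem displacement_add_mul {i : ℕ} (hi : i < γ F M) (p : ℕ) :
    displacement F M (i + γ F M * p) =
      pieceShift F M i - pieceShift F M 0 + displacement F (M + 1) p := by
  rw [displacement_eq, Nat.add_mul_mod_self_left, Nat.mod_eq_of_lt hi,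
    Nat.add_mul_div_left _ _ (γ_pos F M), Nat.div_eq_of_lt hi, zero_add]

theorem displacement_of_lt {i : ℕ} (hi : i < γ F M) :
    displacement F M i = pieceShift F M i - pieceShift F M 0 := by
  simpa only [mul_zero, add_zero, displacement_zero] using displacement_add_mul hi 0

theorem descShift_sub_zero {r p : ℕ} (hp : p < pieces F M r) :
    descShift F M r p - descShift F M r 0 = displacement F M p := by
  induction r generalizing M p with
  | zero =>
    obtain rfl : p = 0 := by simpa [pieces] using hp
    rw [displacement_zero, sub_self]
  | succ r ih =>
    rw [pieces_succ] at hp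
    rw [displacement_eq, ← ih (Nat.div_lt_of_lt_mul hp)]
    simp only [descShift, Nat.zero_mod, Nat.zero_div]
    abel

theorem displacement_sub_of_eq {M' L p : ℕ} (h : ∀ i < L, F (M + i) = F (M' + i)) (hp : p < L) :
    displacement F M' p - displacement F M p = (p * ((height F M' : ℤ) - height F M), 0) := by
  induction p using Nat.strong_induction_on generalizing L M M' with
  | _ p ih =>
  rcases Nat.eq_zero_or_pos p with rfl | hpos
  · simp only [displacement_zero, sub_self, Nat.cast_zero, zero_mul, Prod.mk_zero_zero]
  have h₀ : F M = F M' := h 0 (by omega)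
  have hdiv : p / γ F M < p := Nat.div_lt_self hpos (one_lt_γ F M)
  have hrec := ih _ hdiv (L := L - 1) (M := M + 1) (M' := M' + 1)
    (fun i hi => by simpa only [Nat.add_assoc, Nat.add_comm 1] using h (i + 1) (by omega))
    (by omega)
  calc displacement F M' p - displacement F M p
      = (pieceShift F M' (p % γ F M) - pieceShift F M (p % γ F M)) -
          (pieceShift F M' 0 - pieceShift F M 0) +
          (displacement F (M' + 1) (p / γ F M) - displacement F (M + 1) (p / γ F M)) := by
        rw [displacement_eq F M', displacement_eq F M, ← γ_congr h₀]
        abel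
    _ = (((p % γ F M + γ F M * (p / γ F M) : ℕ) : ℤ) * ((height F M' : ℤ) - height F M), 0) := by
        rw [hrec, height_succ_sub_of_eq h₀, pieceShift_sub_of_eq h₀, pieceShift_sub_of_eq h₀]
        ext
        · simp only [Prod.fst_add, Prod.fst_sub]
          push_cast
          ring
        · simp
    _ = _ := by rw [Nat.mod_add_div]

variable (F M) in
/-- The amount by which the displacement from the `p`-th to the `p + 1`-st piece of a level of
generation `M` exceeds the displacement `t F M 0` from the `0`-th to the first. -/
def excess (p : ℕ) : ℤ × G := displacement F M (p + 1) - displacement F M p - t F M 0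

variable (F M) in
theorem excess_zero : excess F M 0 = 0 := by
  rw [excess, displacement_of_lt (one_lt_γ F M), displacement_zero, sub_zero, pieceShift_succ_sub,
    sub_self]

theorem excess_of_mod_lt {p : ℕ} (h : p % γ F M + 1 < γ F M) :
    excess F M p = t F M (p % γ F M) - t F M 0 := by
  have displacement_succ : displacement F M (p + 1) =
      pieceShift F M (p % γ F M + 1) - pieceShift F M 0 + displacement F (M + 1) (p / γ F M) := by
    rw [← displacement_add_mul h, add_right_comm, Nat.mod_add_div]
  rw [excess, displacement_succ, displacement_eq F M p, ← pieceShift_succ_sub F M (p % γ F M)]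
  abel

variable (F M) in
theorem excess_carry (p : ℕ) :
    excess F M (γ F M - 1 + γ F M * p) = c F M 0 + excess F (M + 1) p := by
  have hγ := γ_pos F M
  have carry : γ F M - 1 + γ F M * p + 1 = 0 + γ F M * (p + 1) := by
    rw [mul_add]
    omega
  rw [excess, carry, displacement_add_mul hγ, displacement_add_mul (Nat.sub_one_lt hγ.ne'),
    excess, t_succ]
  abel

end Displacement

section CGroup

variable {G : Type*} [AddCommGroup G] {F : ℕ → CutOp G}

variable (F) in
/-- The group generated by the vectors `c F M i`. -/
def cGroup : AddSubgroup (ℤ × G) :=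
  AddSubgroup.closure {v | ∃ M i, i + 2 ≤ γ F (M + 1) ∧ v = c F M i}

theorem c_mem_cGroup {M i : ℕ} (h : i + 2 ≤ γ F (M + 1)) : c F M i ∈ cGroup F :=
  AddSubgroup.subset_closure ⟨M, i, h, rfl⟩

variable (F) in
theorem t_succ_sub_t_succ (M i : ℕ) :
    t F (M + 1) i - t F (M + 1) 0 = c F M i - c F M 0 := by
  rw [t_succ, t_succ F M 0, add_sub_add_left_eq_sub]

theorem t_sub_t_zero_mem_cGroup (hF : Recurrent F) {N i : ℕ} (hi : i + 2 ≤ γ F N) :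
    t F N i - t F N 0 ∈ cGroup F := by
  obtain ⟨M, hM, hlt⟩ := (hF N 1).exists_gt 0
  obtain ⟨M, rfl⟩ := Nat.exists_eq_succ_of_ne_zero hlt.ne'
  have h : F N = F (M + 1) := hM 0 one_pos
  have t_sub_eq : t F N i - t F N 0 = t F (M + 1) i - t F (M + 1) 0 := by
    rw [sub_eq_sub_iff_sub_eq_sub, t_sub_of_eq h.symm, t_sub_of_eq h.symm]
  rw [t_sub_eq, t_succ_sub_t_succ]
  exact sub_mem (c_mem_cGroup (γ_congr h ▸ hi)) (c_mem_cGroup (one_lt_γ F _))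

theorem pieceShift_sub_zero_sub_nsmul_mem_cGroup (hF : Recurrent F) {M i : ℕ}
    (hi : i < γ F M) : pieceShift F M i - pieceShift F M 0 - i • t F M 0 ∈ cGroup F := by
  have sum_eq : pieceShift F M i - pieceShift F M 0 - i • t F M 0 =
      ∑ k ∈ Finset.range i, (t F M k - t F M 0) := by
    rw [pieceShift_sub_zero, Finset.sum_sub_distrib, Finset.sum_const, Finset.card_range]
  rw [sum_eq]
  exact sum_mem fun k hk =>
    t_sub_t_zero_mem_cGroup hF (by have := Finset.mem_range.1 hk; omega)

theorem t_succ_sub_nsmul_mem_cGroup (hF : Recurrent F) (M : ℕ) :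
    t F (M + 1) 0 - γ F M • t F M 0 ∈ cGroup F := by
  have hγ := γ_pos F M
  convert add_mem (pieceShift_sub_zero_sub_nsmul_mem_cGroup hF (Nat.sub_one_lt hγ.ne'))
    (c_mem_cGroup (one_lt_γ F (M + 1))) using 1
  have γ_nsmul : γ F M • t F M 0 = (γ F M - 1) • t F M 0 + t F M 0 := by
    rw [← succ_nsmul, Nat.sub_add_cancel hγ]
  rw [t_succ, γ_nsmul]
  abel

theorem displacement_sub_nsmul_mem_cGroup (hF : Recurrent F) (M p : ℕ) :
    displacement F M p - p • t F M 0 ∈ cGroup F := by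
  induction p using Nat.strong_induction_on generalizing M with
  | _ p ih =>
  rcases Nat.eq_zero_or_pos p with rfl | hpos
  · simp only [displacement_zero, zero_smul, sub_zero, zero_mem]
  have within_piece :=
    pieceShift_sub_zero_sub_nsmul_mem_cGroup hF (Nat.mod_lt p (γ_pos F M))
  have between_pieces := add_mem (ih _ (Nat.div_lt_self hpos (one_lt_γ F M)) (M + 1))
    (nsmul_mem (t_succ_sub_nsmul_mem_cGroup hF M) (p / γ F M))
  convert add_mem within_piece between_pieces using 1
  nth_rw 2 [← Nat.mod_add_div p (γ F M)]
  rw [displacement_eq, add_smul, mul_comm, mul_smul, smul_sub]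
  abel

theorem spanGroup_eq_top (hF : Recurrent F) (hgen : ShiftsGenerate F) (hspan : SpanCondition F)
    (N : ℕ) : spanGroup F N = ⊤ := by
  have one_mem : ((1, 0) : ℤ × G) ∈ spanGroup F N := hspan N
  have map_snd : (spanGroup F N).map (AddMonoidHom.snd ℤ G) = ⊤ := by
    rw [eq_top_iff, ← hgen, AddSubgroup.closure_le]
    rintro _ ⟨M, i, hi, rfl⟩
    obtain ⟨M', hM', hlt⟩ := (hF M 1).exists_gt N
    have h : F M = F M' := hM' 0 one_pos
    exact ⟨_, pieceShift_sub_zero_mem_spanGroup hlt.le (γ_congr h ▸ hi),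
      by simp [pieceShift, g_congr h]⟩
  refine (AddSubgroup.eq_top_iff' _).2 fun ⟨a, b⟩ => ?_
  obtain ⟨⟨a', b'⟩, hab, rfl : b' = b⟩ : b ∈ (spanGroup F N).map (AddMonoidHom.snd ℤ G) :=
    map_snd ▸ AddSubgroup.mem_top b
  convert add_mem hab (zsmul_mem one_mem (a - a')) using 1
  ext <;> simp

theorem exists_sub_zsmul_mem_cGroup (hF : Recurrent F) {N : ℕ} (h : spanGroup F N = ⊤)
    (x : ℤ × G) : ∃ m : ℤ, x - m • t F N 0 ∈ cGroup F := by
  have span_le : spanGroup F N ≤ cGroup F ⊔ AddSubgroup.zmultiples (t F N 0) := by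
    refine (AddSubgroup.closure_le _).2 ?_
    rintro _ (⟨i, hi, rfl⟩ | ⟨M, i, hi, rfl⟩)
    · rw [← sub_add_cancel (t F N i) (t F N 0)]
      exact AddSubgroup.add_mem_sup (t_sub_t_zero_mem_cGroup hF hi)
        (AddSubgroup.mem_zmultiples _)
    · exact AddSubgroup.mem_sup_left (c_mem_cGroup hi)
  obtain ⟨y, hy, _, ⟨m, rfl⟩, hx⟩ := AddSubgroup.mem_sup.1 (span_le (h ▸ AddSubgroup.mem_top x))
  exact ⟨m, by rwa [← hx, add_sub_cancel_right]⟩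

theorem exists_zsmul_mem_cGroup (hF : Recurrent F) (h : ∀ N, spanGroup F N = ⊤) :
    ∃ q : ℤ, q ≠ 0 ∧ ∀ x : ℤ × G, q • x ∈ cGroup F := by
  obtain ⟨m, hm⟩ := exists_sub_zsmul_mem_cGroup hF (h 1) (t F 0 0)
  have smul_t_mem : (1 - m * γ F 0 : ℤ) • t F 0 0 ∈ cGroup F := by
    convert add_mem hm (zsmul_mem (t_succ_sub_nsmul_mem_cGroup hF 0) m) using 1
    rw [zero_add, smul_sub, sub_smul, mul_smul, one_smul, natCast_zsmul]
    abel
  refine ⟨1 - m * γ F 0, fun h0 => ?_, fun x => ?_⟩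
  · have hdvd : (γ F 0 : ℤ) ∣ 1 := ⟨m, by linarith⟩
    exact (one_lt_γ F 0).ne' (by exact_mod_cast Int.eq_one_of_dvd_one (by positivity) hdvd)
  · obtain ⟨a, ha⟩ := exists_sub_zsmul_mem_cGroup hF (h 0) x
    convert add_mem (zsmul_mem ha (1 - m * γ F 0 : ℤ)) (zsmul_mem smul_t_mem a) using 1
    rw [smul_sub, smul_comm a, sub_add_cancel]

theorem exists_add_displacement_mem_cGroup (hF : Recurrent F) (h : ∀ N, spanGroup F N = ⊤) :
    ∃ L, ∀ M x, ∃ p < L, x + displacement F M p ∈ cGroup F := by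
  obtain ⟨q, hq, hqc⟩ := exists_zsmul_mem_cGroup hF h
  refine ⟨q.natAbs, fun M x => ?_⟩
  obtain ⟨m, hm⟩ := exists_sub_zsmul_mem_cGroup hF (h M) x
  obtain ⟨p, hp⟩ := Int.eq_ofNat_of_zero_le (Int.emod_nonneg (-m) hq)
  have hlt := Int.abs_eq_natAbs q ▸ Int.emod_lt_abs (-m) hq
  refine ⟨p, by omega, ?_⟩
  have hmp : m + p = q * (-(-m / q)) := by linarith [Int.emod_add_mul_ediv (-m) q]
  have hmul : (m + p) • t F M 0 ∈ cGroup F := by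
    rw [hmp, mul_smul]
    exact hqc _
  convert add_mem (add_mem hm (displacement_sub_nsmul_mem_cGroup hF M p)) hmul using 1
  rw [add_smul, natCast_zsmul]
  abel

end CGroup

section PeriodGroup

variable {G : Type*} [AddCommGroup G] {F : ℕ → CutOp G}

variable (F) in
/-- The group generated by the differences of excesses at indices congruent modulo `k`. -/
def periodGroup (k : ℕ) : AddSubgroup (ℤ × G) :=
  AddSubgroup.closure {v | ∃ M p q, p ≡ q [MOD k] ∧ v = excess F M p - excess F M q}

/-- Induction on `k`: if `γ F M ∣ k`, restricting to the indices at which a carry occurs replaces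
`M` by `M + 1` and `k` by `k / γ F M`; otherwise, adding `k` turns a carry into no carry. -/
theorem exists_forall_excess_mem (W : AddSubgroup (ℤ × G)) {k : ℕ} (hk : 0 < k) {M : ℕ}
    (h : ∀ p q, p ≡ q [MOD k] → excess F M p - excess F M q ∈ W) :
    ∃ M', ∀ p, excess F M' p ∈ W := by
  induction k using Nat.strong_induction_on generalizing M with
  | _ k ih =>
  have hγ := one_lt_γ F M
  by_cases hd : γ F M ∣ k
  · obtain ⟨k', rfl⟩ := hd
    have hk' : 0 < k' := Nat.pos_of_mul_pos_left hk
    refine ih k' (lt_mul_of_one_lt_left hk' hγ) hk' (M := M + 1) fun p q hpq => ?_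
    simpa only [excess_carry, add_sub_add_left_eq_sub] using
      h _ _ ((hpq.mul_left' (γ F M)).add_left (γ F M - 1))
  · have no_carry : (γ F M - 1 + k) % γ F M + 1 < γ F M := by
      have hlt := Nat.mod_lt (γ F M - 1 + k) (γ_pos F M)
      have hmod := Nat.mod_add_div (γ F M - 1 + k) (γ F M)
      by_contra hcon
      exact hd ⟨(γ F M - 1 + k) / γ F M, by omega⟩
    have carry_sub_mem (p : ℕ) : c F M 0 + excess F (M + 1) p -
        (t F M ((γ F M - 1 + k) % γ F M) - t F M 0) ∈ W := by
      have hmod : (γ F M - 1 + γ F M * p + k) % γ F M = (γ F M - 1 + k) % γ F M := by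
        rw [add_right_comm, Nat.add_mul_mod_self_left]
      have no_carry' : (γ F M - 1 + γ F M * p + k) % γ F M + 1 < γ F M := by rwa [hmod]
      have hmem := h (γ F M - 1 + γ F M * p) (γ F M - 1 + γ F M * p + k) (by simp [Nat.ModEq])
      rwa [excess_carry, excess_of_mod_lt no_carry', hmod] at hmem
    refine ⟨M + 1, fun p => ?_⟩
    simpa only [excess_zero, sub_sub_sub_cancel_right, add_zero, add_sub_cancel_left] using
      sub_mem (carry_sub_mem p) (carry_sub_mem 0)

theorem exists_forall_ge_excess_mem_periodGroup {k : ℕ} (hk : 0 < k) :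
    ∃ M', ∀ M ≥ M', ∀ p, excess F M p ∈ periodGroup F k := by
  obtain ⟨M', hM'⟩ := exists_forall_excess_mem (periodGroup F k) hk (M := 0) fun p q hpq =>
    AddSubgroup.subset_closure ⟨0, p, q, hpq, rfl⟩
  refine ⟨M', fun M hM => ?_⟩
  induction M, hM using Nat.le_induction with
  | base => exact hM'
  | succ M _ ih =>
    intro p
    simpa only [excess_carry, excess_zero, add_zero, add_sub_cancel_left] using
      sub_mem (ih (γ F M - 1 + γ F M * p)) (ih (γ F M - 1 + γ F M * 0))

theorem cGroup_le_periodGroup (hF : Recurrent F) {k : ℕ} (hk : 0 < k) :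
    cGroup F ≤ periodGroup F k := by
  obtain ⟨M', hM'⟩ := exists_forall_ge_excess_mem_periodGroup (F := F) hk
  refine (AddSubgroup.closure_le _).2 ?_
  rintro _ ⟨M, i, hi, rfl⟩
  obtain ⟨m, hm, hlt⟩ := (hF M 2).exists_gt M'
  have h₀ : F M = F m := hm 0 two_pos
  have h₁ : F (M + 1) = F (m + 1) := hm 1 one_lt_two
  rw [γ_congr h₁] at hi
  have hmod : i % γ F (m + 1) = i := Nat.mod_eq_of_lt (by omega)
  rw [SetLike.mem_coe, c_congr h₀ h₁]
  convert hM' m hlt.le (γ F m - 1 + γ F m * i) using 1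
  rw [excess_carry, excess_of_mod_lt (by omega), hmod, t_succ_sub_t_succ, add_sub_cancel]

end PeriodGroup

section Meets

theorem pieces_mul_width {G : Type*} (F : ℕ → CutOp G) (N r : ℕ) :
    pieces F N r * width F (N + r) = width F N := by
  induction r with
  | zero => simp [pieces]
  | succ r ih =>
    rw [pieces, Finset.prod_range_succ, ← pieces, Nat.cast_mul, mul_assoc, ← Nat.add_assoc,
      γ_mul_width_succ, ih]

theorem pieces_congr {G : Type*} {F : ℕ → CutOp G} {M M' L : ℕ}
    (h : ∀ i < L, F (M + i) = F (M' + i)) : pieces F M L = pieces F M' L :=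
  Finset.prod_congr rfl fun i hi => γ_congr (h i (Finset.mem_range.1 hi))

theorem volume_cube_width {G : Type*} (F : ℕ → CutOp G) {ι : Type*} [Fintype ι] (N r : ℕ) :
    volume (cube (0 : ι → ℝ) (width F N)) =
      (pieces F N r : ENNReal) ^ Fintype.card ι * volume (cube (0 : ι → ℝ) (width F (N + r))) := by
  rw [volume_cube, volume_cube, ← mul_pow, ← ENNReal.ofReal_natCast,
    ← ENNReal.ofReal_mul (Nat.cast_nonneg _), pieces_mul_width]

theorem add_lt_of_le_inv_four_mul {a b c : ENNReal} (h₀ : c ≠ 0) (h : c ≠ ⊤) (ha : a ≤ 4⁻¹ * c)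
    (hb : b ≤ 4⁻¹ * c) : a + b < c := by
  refine (add_le_add ha hb).trans_lt ?_
  rw [← add_mul]
  conv_rhs => rw [← one_mul c]
  refine ENNReal.mul_lt_mul_left h₀ h ?_
  rw [← ENNReal.toReal_lt_toReal (by simp) (by simp), ENNReal.toReal_add (by simp) (by simp)]
  norm_num

variable {G : Type*} [AddCommGroup G] {F : ℕ → CutOp G} {ι : Type*} [Fintype ι]
  {A B : Set (ι → ℝ × G)} {v : ι → ℤ × G}

variable (F A B v) in
/-- In some generation there are two products of levels with addresses `z l` and `z' l`,
`z - z' = v`, such that `A`, in the first product, and `B`, in the second one, meet in a set of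
positive measure after the first product has been translated onto the second one. -/
def Meets : Prop :=
  ∃ (N : ℕ) (z z' : ι → ℤ × G), (∀ l, IsAddress F N (z l)) ∧ (∀ l, IsAddress F N (z' l)) ∧
    z - z' = v ∧ 0 < volume (pull F A N z ∩ pull F B N z')

theorem meets_of_volume_sdiff_le {N : ℕ} {z z' : ι → ℤ × G} (hz : ∀ l, IsAddress F N (z l))
    (hz' : ∀ l, IsAddress F N (z' l))
    (h : volume (cube 0 (width F N) \ pull F A N z) ≤
      4⁻¹ * volume (cube (0 : ι → ℝ) (width F N)))
    (h' : volume (cube 0 (width F N) \ pull F B N z') ≤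
      4⁻¹ * volume (cube (0 : ι → ℝ) (width F N))) : Meets F A B (z - z') :=
  ⟨N, z, z', hz, hz', rfl, measure_inter_pos_of_add_lt (add_lt_of_le_inv_four_mul
    (volume_cube_zero_pos (width_pos F N)).ne' (volume_cube_ne_top _ _) h h')⟩

theorem volume_cube_sdiff_pull_le_of_subset {N : ℕ} {z : ι → ℤ × G}
    (hz : ∀ l, IsAddress F N (z l)) {C : Set (ι → ℝ)} (hC : C ⊆ pull F A N z) (r : ℕ)
    (p : ι → ℕ) :
    volume (cube 0 (width F (N + r)) \ pull F A (N + r) fun l => z l + descShift F N r (p l)) ≤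
      volume (cube 0 (width F (N + r)) \ ((fun l => offset F N r (p l)) + ·) ⁻¹' C) := by
  rw [pull_add_descShift hz, Set.sdiff_self_inter]
  exact measure_mono (Set.sdiff_subset_sdiff_right (Set.preimage_mono hC))

variable [MeasurableSpace G]

theorem Meets.exists_volume_sdiff_le (hA : MeasurableSet A) (hB : MeasurableSet B)
    (h : Meets F A B v) {ε : ENNReal} (hε : ε ≠ 0) :
    ∃ K, ∀ M ≥ K, ∃ z z' : ι → ℤ × G, (∀ l, IsAddress F M (z l)) ∧
      (∀ l, IsAddress F M (z' l)) ∧ z - z' = v ∧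
      volume (cube 0 (width F M) \ pull F A M z) ≤
        ε * volume (cube (0 : ι → ℝ) (width F M)) ∧
      volume (cube 0 (width F M) \ pull F B M z') ≤
        ε * volume (cube (0 : ι → ℝ) (width F M)) := by
  obtain ⟨N, z, z', hz, hz', rfl, h₀⟩ := h
  obtain ⟨K, hK⟩ := exists_piece_volume_sdiff_le
    ((measurableSet_pull hA N z).inter (measurableSet_pull hB N z'))
    (Set.inter_subset_left.trans Set.inter_subset_left) h₀.ne' hε
  refine ⟨N + K, fun M hM => ?_⟩
  obtain ⟨r, rfl⟩ := Nat.exists_eq_add_of_le (le_of_add_le_left hM)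
  obtain ⟨p, hp⟩ := hK r (by omega)
  exact ⟨_, _, fun l => (hz l).add_descShift r (p l), fun l => (hz' l).add_descShift r (p l),
    funext fun l => add_sub_add_right_eq_sub _ _ _,
    (volume_cube_sdiff_pull_le_of_subset hz Set.inter_subset_left r p).trans hp,
    (volume_cube_sdiff_pull_le_of_subset hz' Set.inter_subset_right r p).trans hp⟩

theorem Meets.refine (hF : Recurrent F) (hA : MeasurableSet A) (hB : MeasurableSet B)
    (h : Meets F A B v) (n L K : ℕ) :
    ∃ M ≥ K, (∀ i < L, F (n + i) = F (M + i)) ∧ ∀ u u' : ι → ℕ, (∀ l, u l < L) →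
      (∀ l, u' l < L) →
      Meets F A B (v + fun l => displacement F M (u l) - displacement F M (u' l)) := by
  have hP : (pieces F n L : ENNReal) ^ Fintype.card ι ≠ 0 :=
    pow_ne_zero _ (Nat.cast_ne_zero.2 (Nat.ne_zero_of_lt (lt_pieces F n L)))
  have hP' : (pieces F n L : ENNReal) ^ Fintype.card ι ≠ ⊤ :=
    ENNReal.pow_ne_top (ENNReal.natCast_ne_top _)
  obtain ⟨K', hK'⟩ := h.exists_volume_sdiff_le hA hB
    (ε := 4⁻¹ * ((pieces F n L : ENNReal) ^ Fintype.card ι)⁻¹)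
    (mul_ne_zero (by simp) (ENNReal.inv_ne_zero.2 hP'))
  obtain ⟨M, hM, hlt⟩ := (hF n L).exists_gt (K + K')
  refine ⟨M, by omega, hM, fun u u' hu hu' => ?_⟩
  obtain ⟨z, z', hz, hz', rfl, hzA, hzB⟩ := hK' M (by omega)
  have volume_scale : 4⁻¹ * ((pieces F n L : ENNReal) ^ Fintype.card ι)⁻¹ *
      volume (cube (0 : ι → ℝ) (width F M)) =
      4⁻¹ * volume (cube (0 : ι → ℝ) (width F (M + L))) := by
    rw [volume_cube_width F M L, ← pieces_congr hM, mul_assoc,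
      ← mul_assoc ((pieces F n L : ENNReal) ^ Fintype.card ι)⁻¹, ENNReal.inv_mul_cancel hP hP',
      one_mul]
  rw [volume_scale] at hzA hzB
  convert meets_of_volume_sdiff_le (fun l => (hz l).add_descShift L (u l))
    (fun l => (hz' l).add_descShift L (u' l))
    ((volume_cube_sdiff_pull_add_descShift_le hz L u).trans hzA)
    ((volume_cube_sdiff_pull_add_descShift_le hz' L u').trans hzB) using 1
  funext l
  simp only [Pi.add_apply, Pi.sub_apply,
    ← descShift_sub_zero ((hu l).trans (lt_pieces F M L)),
    ← descShift_sub_zero ((hu' l).trans (lt_pieces F M L))]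
  abel

variable [MeasurableSingletonClass G] [Countable G]

theorem exists_volume_sdiff_pull_le (hA : MeasurableSet A)
    (h₀ : (Measure.pi fun _ : ι => μ F) A ≠ 0) {ε : ENNReal} (hε : ε ≠ 0) :
    ∃ K, ∀ M ≥ K, ∃ z : ι → ℤ × G, (∀ l, IsAddress F M (z l)) ∧
      volume (cube 0 (width F M) \ pull F A M z) ≤
        ε * volume (cube (0 : ι → ℝ) (width F M)) := by
  obtain ⟨N, z, hz, h₀⟩ := exists_volume_pull_ne_zero hA h₀
  obtain ⟨K, hK⟩ :=
    exists_piece_volume_sdiff_le (measurableSet_pull hA N z) Set.inter_subset_left h₀ hε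
  refine ⟨N + K, fun M hM => ?_⟩
  obtain ⟨r, rfl⟩ := Nat.exists_eq_add_of_le (le_of_add_le_left hM)
  obtain ⟨p, hp⟩ := hK r (by omega)
  exact ⟨_, fun l => (hz l).add_descShift r (p l),
    (volume_cube_sdiff_pull_le_of_subset hz subset_rfl r p).trans hp⟩

theorem exists_meets (hA : MeasurableSet A) (hB : MeasurableSet B)
    (hA₀ : (Measure.pi fun _ : ι => μ F) A ≠ 0) (hB₀ : (Measure.pi fun _ : ι => μ F) B ≠ 0) :
    ∃ v, Meets F A B v := by
  have hε : (4⁻¹ : ENNReal) ≠ 0 := by simp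
  obtain ⟨K, hK⟩ := exists_volume_sdiff_pull_le hA hA₀ hε
  obtain ⟨K', hK'⟩ := exists_volume_sdiff_pull_le hB hB₀ hε
  obtain ⟨z, hz, hzA⟩ := hK _ (le_max_left K K')
  obtain ⟨z', hz', hzB⟩ := hK' _ (le_max_right K K')
  exact ⟨_, meets_of_volume_sdiff_le hz hz' hzA hzB⟩

theorem Meets.measure_pos {n : ℕ} {k : ι → ℤ} (h : Meets F A B fun l => (k l * n, 0)) :
    0 < (Measure.pi fun _ : ι => μ F)
      ((fun x l => Tpow F (k l) (x l))^[n] ⁻¹' A ∩ B) := by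
  obtain ⟨N, z, z', hz, hz', hv, h₀⟩ := h
  obtain rfl : z = fun l => z' l + (k l * n, 0) := (sub_eq_iff_eq_add'.1 hv)
  have iterate_point {y : ι → ℝ} (hy : y ∈ cube 0 (width F N)) :
      (fun x l => Tpow F (k l) (x l))^[n] (fun l => point F N (z' l) (y l)) =
        fun l => point F N (z' l + (k l * n, 0)) (y l) := by
    refine (congrFun (Pi.map_iterate (fun l => Tpow F (k l)) n) _).trans (funext fun l => ?_)
    exact Tpow_iterate_point (hz' l) (hz l) (mem_cube_zero_iff.1 hy l)
  calc 0 < volume (pull F A N (fun l => z' l + (k l * n, 0)) ∩ pull F B N z') := h₀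
    _ ≤ volume ((fun y l => point F N (z' l) (y l)) ⁻¹'
          ((fun x l => Tpow F (k l) (x l))^[n] ⁻¹' A ∩ B) ∩ cube 0 (width F N)) := by
        refine measure_mono ?_
        rintro y ⟨⟨hy, hyA⟩, -, hyB⟩
        exact ⟨⟨by rwa [Set.mem_preimage, iterate_point hy], hyB⟩, hy⟩
    _ ≤ (volume.restrict (cube 0 (width F N))) _ := Measure.le_restrict_apply _ _
    _ ≤ ((volume.restrict (cube 0 (width F N))).map fun y l => point F N (z' l) (y l)) _ :=
        Measure.le_map_apply (measurable_points z').aemeasurable _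
    _ ≤ _ := by
        rw [← restrict_pi_level_entry hz']
        exact Measure.restrict_apply_le _ _

end Meets

section Translates

/-- The group of all vectors whose addition and subtraction preserve the property `P`. -/
def translates {V : Type*} [AddCommGroup V] (P : V → Prop) : AddSubgroup V where
  carrier := {x | ∀ v, (P v → P (v + x)) ∧ (P v → P (v - x))}
  zero_mem' v := by simp
  add_mem' {x y} hx hy v :=
    ⟨fun h => add_assoc v x y ▸ (hy _).1 ((hx _).1 h),
      fun h => sub_sub v x y ▸ (hy _).2 ((hx _).2 h)⟩
  neg_mem' {x} hx v :=
    ⟨fun h => sub_eq_add_neg v x ▸ (hx v).2 h, fun h => (sub_neg_eq_add v x).symm ▸ (hx v).1 h⟩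

theorem apply_zero_of_mem_translates {V : Type*} [AddCommGroup V] {P : V → Prop} {v : V}
    (hv : v ∈ translates P) (h : P v) : P 0 := by
  simpa using (hv v).2 h

end Translates

section MeetsUpTo

variable {G : Type*} [AddCommGroup G] {F : ℕ → CutOp G} {ι : Type*} [Fintype ι]
  {A B : Set (ι → ℝ × G)} {k : ι → ℤ} {v : ι → ℤ × G}

theorem displacement_sub_displacement_of_eq {M M' L p q : ℕ}
    (h : ∀ i < L, F (M + i) = F (M' + i)) (hp : p < L) (hq : q < L) :
    displacement F M' p - displacement F M' q = displacement F M p - displacement F M q +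
      (((p : ℤ) - q) * ((height F M' : ℤ) - height F M), 0) := by
  have hp := sub_eq_iff_eq_add.1 (displacement_sub_of_eq h hp)
  have hq := sub_eq_iff_eq_add.1 (displacement_sub_of_eq h hq)
  rw [hp, hq, sub_mul, ← sub_zero (0 : G), ← Prod.mk_sub_mk, sub_zero]
  abel

variable (F A B k v) in
/-- Some products of levels meet whose addresses differ by `v`, up to a common number of
iterations of the product of the powers `T^{k l}`. -/
def MeetsUpTo : Prop :=
  ∃ n : ℕ, Meets F A B fun l => v l + (k l * n, 0)

variable [MeasurableSpace G]

theorem Meets.exists_mem_cGroup (hF : Recurrent F) (hA : MeasurableSet A) (hB : MeasurableSet B)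
    (hspan : ∀ N, spanGroup F N = ⊤) (h : Meets F A B v) :
    ∃ v, Meets F A B v ∧ ∀ l, v l ∈ cGroup F := by
  obtain ⟨L, hL⟩ := exists_add_displacement_mem_cGroup hF hspan
  obtain ⟨M, -, -, hM⟩ := h.refine hF hA hB 0 L 0
  choose p hp hmem using fun l => hL M (v l)
  refine ⟨_, hM p 0 hp fun l => (Nat.zero_le _).trans_lt (hp l), fun l => ?_⟩
  simpa only [Pi.add_apply, Pi.zero_apply, displacement_zero, sub_zero] using hmem l

/-- Refining along `w', w` and then, much later, along `u, u'` repeats the same operations at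
two different heights; what remains besides the displacements is the height difference. -/
theorem Meets.exists_add_displacement (hF : Recurrent F) (hA : MeasurableSet A)
    (hB : MeasurableSet B) (h : Meets F A B v) (m K : ℕ) {u u' w w' : ι → ℕ} {ρ : ι → ℤ}
    (hu : ∀ l, (u l : ℤ) - u' l = ρ l) (hw : ∀ l, (w l : ℤ) - w' l = ρ l) :
    ∃ n : ℕ, K ≤ n ∧ Meets F A B fun l => v l + (displacement F m (u l) - displacement F m (u' l) -
      (displacement F m (w l) - displacement F m (w' l))) + (ρ l * n, 0) := by
  obtain ⟨L, hL⟩ : ∃ L, ∀ l, u l < L ∧ u' l < L ∧ w l < L ∧ w' l < L := by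
    refine ⟨∑ l, (u l + u' l + w l + w' l) + 1, fun l => ?_⟩
    have := Finset.single_le_sum (f := fun l => u l + u' l + w l + w' l)
      (fun _ _ => Nat.zero_le _) (Finset.mem_univ l)
    grind
  obtain ⟨M, -, hM, h⟩ := h.refine hF hA hB m L 0
  obtain ⟨M', hMM', hM', h⟩ := (h w' w (fun l => (hL l).2.2.2) fun l => (hL l).2.2.1).refine
    hF hA hB m L (K + height F M)
  have hheight : M' ≤ height F M' := (height_strictMono F).le_apply
  refine ⟨height F M' - height F M, by omega, ?_⟩
  convert h u u' (fun l => (hL l).1) (fun l => (hL l).2.1) using 1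
  funext l
  have hdisp := displacement_sub_displacement_of_eq hM (hL l).2.2.2 (hL l).2.2.1
  have hdisp' := displacement_sub_displacement_of_eq hM' (hL l).1 (hL l).2.1
  rw [hu] at hdisp'
  rw [← neg_sub (w l : ℤ), hw] at hdisp
  simp only [Pi.add_apply, hdisp, hdisp']
  have hcast : ((height F M' - height F M : ℕ) : ℤ) = (height F M' : ℤ) - height F M :=
    Nat.cast_sub (by omega)
  have hρ : (ρ l * ((height F M' - height F M : ℕ) : ℤ), (0 : G)) =
      (-ρ l * ((height F M : ℤ) - height F m), 0) +
        (ρ l * ((height F M' : ℤ) - height F m), 0) := by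
    rw [hcast, Prod.mk_add_mk, add_zero]
    congr 1
    ring
  rw [hρ]
  abel

theorem MeetsUpTo.add_displacement (hF : Recurrent F) (hA : MeasurableSet A)
    (hB : MeasurableSet B) (h : MeetsUpTo F A B k v) (m ρ : ℕ) {u u' w w' : ι → ℕ}
    (hu : ∀ l, (u l : ℤ) - u' l = ρ * k l) (hw : ∀ l, (w l : ℤ) - w' l = ρ * k l) :
    MeetsUpTo F A B k (v + fun l => displacement F m (u l) - displacement F m (u' l) -
      (displacement F m (w l) - displacement F m (w' l))) := by
  obtain ⟨n, h⟩ := h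
  obtain ⟨n', -, h⟩ := h.exists_add_displacement hF hA hB m 0 hu hw
  refine ⟨n + ρ * n', ?_⟩
  convert h using 1
  funext l
  have hsplit : (k l * ((n + ρ * n' : ℕ) : ℤ), (0 : G)) = (k l * n, 0) + (ρ * k l * n', 0) := by
    rw [Prod.mk_add_mk, add_zero]
    congr 1
    push_cast
    ring
  rw [hsplit, Pi.add_apply]
  abel

theorem single_excess_sub_mem_translates [DecidableEq ι] (hF : Recurrent F)
    (hA : MeasurableSet A) (hB : MeasurableSet B) (l : ι) (m : ℕ) {p q ρ : ℕ}
    (hpq : (p : ℤ) - q = ρ * k l) :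
    Pi.single l (excess F m p - excess F m q) ∈ translates (MeetsUpTo F A B k) := by
  let w : ι → ℕ := Function.update (fun j => (ρ * k j).toNat) l p
  let w' : ι → ℕ := Function.update (fun j => (-(ρ * k j)).toNat) l q
  let u : ι → ℕ := Function.update w l (p + 1)
  let u' : ι → ℕ := Function.update w' l (q + 1)
  have hw (j : ι) : (w j : ℤ) - w' j = ρ * k j := by
    rcases eq_or_ne j l with rfl | hj
    · simpa [w, w'] using hpq
    · simp only [w, w', Function.update_of_ne hj]
      omega
  have hu (j : ι) : (u j : ℤ) - u' j = ρ * k j := by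
    rcases eq_or_ne j l with rfl | hj
    · simpa [u, u'] using hpq
    · simpa only [u, u', Function.update_of_ne hj] using hw j
  have hsingle : Pi.single l (excess F m p - excess F m q) = fun j =>
      displacement F m (u j) - displacement F m (u' j) -
        (displacement F m (w j) - displacement F m (w' j)) := by
    funext j
    rcases eq_or_ne j l with rfl | hj
    · simp only [u, u', w, w', Pi.single_eq_same, Function.update_self, excess]
      abel
    · simp only [u, u', Pi.single_eq_of_ne hj, Function.update_of_ne hj, sub_self]
  refine fun v => ⟨fun h => ?_, fun h => ?_⟩
  · rw [hsingle]
    exact h.add_displacement hF hA hB m ρ hu hw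
  · rw [hsingle, sub_eq_add_neg]
    simpa only [Pi.neg_def, neg_sub] using h.add_displacement hF hA hB m ρ hw hu

theorem single_mem_translates [DecidableEq ι] (hF : Recurrent F) (hA : MeasurableSet A)
    (hB : MeasurableSet B) {l : ι} (hk : k l ≠ 0) {x : ℤ × G} (hx : x ∈ cGroup F) :
    Pi.single l x ∈ translates (MeetsUpTo F A B k) := by
  have hperiod : periodGroup F (k l).natAbs ≤
      (translates (MeetsUpTo F A B k)).comap (AddMonoidHom.single (fun _ => ℤ × G) l) := by
    rw [periodGroup, AddSubgroup.closure_le]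
    rintro _ ⟨M, p, q, hpq, rfl⟩
    change Pi.single l _ ∈ translates _
    obtain ⟨ρ, hρ⟩ : k l ∣ (p : ℤ) - q := Int.natAbs_dvd.1 hpq.symm.dvd
    rcases le_total 0 ρ with h | h
    · lift ρ to ℕ using h
      exact single_excess_sub_mem_translates hF hA hB l M (hρ.trans (mul_comm _ _))
    · obtain ⟨ρ, rfl⟩ := Int.exists_eq_neg_ofNat h
      rw [← neg_sub, Pi.single_neg]
      exact neg_mem (single_excess_sub_mem_translates (ρ := ρ) hF hA hB l M (by linarith))
  exact hperiod (cGroup_le_periodGroup hF (Int.natAbs_pos.2 hk) hx)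

theorem Meets.exists_mul_of_forall_mem_cGroup (hF : Recurrent F) (hA : MeasurableSet A)
    (hB : MeasurableSet B) (h : Meets F A B v) (hv : ∀ l, v l ∈ cGroup F) (hk : ∀ l, k l ≠ 0) :
    ∃ n : ℕ, Meets F A B fun l => (k l * n, 0) := by
  classical
  have hmem : v ∈ translates (MeetsUpTo F A B k) := by
    rw [← Finset.univ_sum_single v]
    exact sum_mem fun l _ => single_mem_translates hF hA hB (hk l) (hv l)
  have hupTo : MeetsUpTo F A B k v := ⟨0, by simpa [← Prod.zero_eq_mk] using h⟩
  simpa only [MeetsUpTo, Pi.zero_apply, zero_add] using apply_zero_of_mem_translates hmem hupTo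

end MeetsUpTo

section Main

variable {G : Type*} [AddCommGroup G] [MeasurableSpace G] {F : ℕ → CutOp G}

theorem Meets.exists_snd_eq_zero {ι : Type*} [Fintype ι] [Unique ι] {A B : Set (ι → ℝ × G)}
    {v : ι → ℤ × G} (hF : Recurrent F) (hgen : ShiftsGenerate F) (hA : MeasurableSet A)
    (hB : MeasurableSet B) (h : Meets F A B v) :
    ∃ v, Meets F A B v ∧ (v default).2 = 0 := by
  let P (b : G) : Prop := ∃ v, Meets F A B v ∧ (v default).2 = b
  have add_g_sub {m i j : ℕ} (hi : i < γ F m) (hj : j < γ F m) {b : G} :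
      P b → P (b + (g F m i - g F m j)) := by
    rintro ⟨v, h, rfl⟩
    obtain ⟨M, -, hM, h⟩ := h.refine hF hA hB m (γ F m) 0
    have hmM : F m = F M := hM 0 (γ_pos F m)
    refine ⟨_, h (fun _ => i) (fun _ => j) (fun _ => hi) (fun _ => hj), ?_⟩
    rw [γ_congr hmM] at hi hj
    simp [displacement_of_lt hi, displacement_of_lt hj, pieceShift, g_congr hmM]
  have hclosure : (⊤ : AddSubgroup G) ≤ translates P := by
    rw [← show _ = (⊤ : AddSubgroup G) from hgen, AddSubgroup.closure_le]
    rintro _ ⟨m, i, hi, rfl⟩ b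
    refine ⟨add_g_sub hi (γ_pos F m), ?_⟩
    rw [sub_eq_add_neg b, neg_sub]
    exact add_g_sub (γ_pos F m) hi
  exact apply_zero_of_mem_translates (hclosure (AddSubgroup.mem_top (v default).2)) ⟨v, h, rfl⟩

theorem isErgodic_of_isErgodic_pi {ι Y : Type*} [Unique ι] [MeasurableSpace Y] {ν : Measure Y}
    [SigmaFinite ν] {f : Y → Y}
    (h : IsErgodic (Measure.pi fun _ : ι => ν) fun x i => f (x i)) : IsErgodic ν f := by
  intro A B hA hB hA₀ hB₀
  have measure_preimage (S : Set Y) :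
      (Measure.pi fun _ : ι => ν) (MeasurableEquiv.funUnique ι Y ⁻¹' S) = ν S :=
    (measurePreserving_funUnique ν ι).measure_preimage_equiv S
  obtain ⟨i, hi⟩ := h _ _ (MeasurableEquiv.measurable _ hA) (MeasurableEquiv.measurable _ hB)
    (by rwa [measure_preimage]) (by rwa [measure_preimage])
  refine ⟨i, ?_⟩
  rw [← measure_preimage]
  convert hi using 2
  ext x
  simp only [Set.mem_preimage, Set.mem_inter_iff]
  rw [show (fun (x : ι → Y) l => f (x l))^[i] x = _ from
    congrFun (Pi.map_iterate (fun _ => f) i) x]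
  rfl

variable [MeasurableSingletonClass G] [Countable G]

theorem powerWeaklyMixing_of_conditions (hF : Recurrent F) (hgen : ShiftsGenerate F)
    (hspan : SpanCondition F) : PowerWeaklyMixing F := by
  intro d k _ hk A B hA hB hA₀ hB₀
  obtain ⟨v, h⟩ := exists_meets hA hB hA₀.ne' hB₀.ne'
  obtain ⟨v, h, hv⟩ := h.exists_mem_cGroup hF hA hB (spanGroup_eq_top hF hgen hspan)
  obtain ⟨n, h⟩ := h.exists_mul_of_forall_mem_cGroup hF hA hB hv hk
  exact ⟨n, h.measure_pos⟩

theorem isErgodic_of_shiftsGenerate (hF : Recurrent F) (hgen : ShiftsGenerate F) :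
    IsErgodic (μ F) (T F) := by
  refine isErgodic_of_isErgodic_pi (ι := Unit) fun A B hA hB hA₀ hB₀ => ?_
  obtain ⟨v, h⟩ := exists_meets hA hB hA₀.ne' hB₀.ne'
  obtain ⟨v, h, hv⟩ := h.exists_snd_eq_zero hF hgen hA hB
  obtain ⟨n, hn, h⟩ := h.exists_add_displacement hF hA hB 0 (v ()).1.natAbs
    (u := 1) (u' := 0) (w := 1) (w' := 0) (ρ := 1) (fun _ => by simp) (fun _ => by simp)
  refine ⟨((v ()).1 + n).toNat, Meets.measure_pos (k := fun _ => 1) ?_⟩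
  convert h using 1
  funext l
  rw [Int.toNat_of_nonneg (by omega)]
  ext
  · simp
  · simpa using hv.symm

theorem totallyErgodic_of_powerWeaklyMixing (h : PowerWeaklyMixing F) : TotallyErgodic F :=
  fun n hn => isErgodic_of_isErgodic_pi
    (h 1 (fun _ => (n : ℤ)) one_pos fun _ => Nat.cast_ne_zero.2 hn.ne')

end Main

end CutStack

end

theorem mainTheorem1 {G : Type*} [AddCommGroup G] [Countable G] [MeasurableSpace G]
    [DiscreteMeasurableSpace G] (F : ℕ → CutOp G) (hF : CutStack.Recurrent F) :
    (CutStack.PowerWeaklyMixing F ↔ CutStack.ShiftsGenerate F ∧ CutStack.SpanCondition F) ∧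
    (CutStack.PowerWeaklyMixing F ↔ CutStack.TotallyErgodic F) ∧
    (CutStack.IsErgodic (CutStack.μ F) (CutStack.T F) ↔ CutStack.ShiftsGenerate F) := by
  have conditions_of_totallyErgodic (h : CutStack.TotallyErgodic F) :
      CutStack.ShiftsGenerate F ∧ CutStack.SpanCondition F :=
    ⟨CutStack.shiftsGenerate_of_isErgodic (h 1 one_pos), CutStack.spanCondition_of_totallyErgodic h⟩
  have powerWeaklyMixing_of_conditions
      (h : CutStack.ShiftsGenerate F ∧ CutStack.SpanCondition F) : CutStack.PowerWeaklyMixing F :=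
    CutStack.powerWeaklyMixing_of_conditions hF h.1 h.2
  have totallyErgodic_of_powerWeaklyMixing :
      CutStack.PowerWeaklyMixing F → CutStack.TotallyErgodic F :=
    CutStack.totallyErgodic_of_powerWeaklyMixing
  exact ⟨⟨fun h => conditions_of_totallyErgodic (totallyErgodic_of_powerWeaklyMixing h),
      powerWeaklyMixing_of_conditions⟩,
    ⟨totallyErgodic_of_powerWeaklyMixing,
      fun h => powerWeaklyMixing_of_conditions (conditions_of_totallyErgodic h)⟩,
    CutStack.shiftsGenerate_of_isErgodic, CutStack.isErgodic_of_shiftsGenerate hF⟩
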